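/- For $x\in[0,1)$ define the digits $a'_k=a'_k(x)$, $k\ge 1$, of its negative continued fraction expansion $$x=1-\cfrac{1}{a'_1-\cfrac{1}{a'_2-\cdots}}$$ by $a'_k=-\left\lfloor -1/T^{k-1}(1-x)\right\rfloor$, where $T(y)=-\frac1y-\left\lfloor-\frac1y\right\rfloor$ for $y\ne0$ and $T(0)=0$. (For irrational $x$ this is the usual expansion, with all $a'_k\ge2$; at the rational $x$, a null set, read $-1/0$ as $0$.) Let $\lambda$ denote Lebesgue measure. Then: 1. For every $\varepsilon>0$, $$\lim_{n\to\infty}\lambda\left(\left\{x\in[0,1):\left|\frac1n\sum_{k=1}^n a'_k(x)-3\right|>\varepsilon\right\}\right)=0,$$ that is, the arithmetic mean of the digits converges to $3$ in Lebesgue measure on $[0,1)$. 2. It is not true that $\frac1n\sum_{k=1}^n a'_k(x)$ converges to $3$ for almost every $x\in[0,1)$. 3. For almost every $x\in[0,1)$, $$\liminf_{n\to\infty}\frac1n\sum_{k=1}^n a'_k(x)=2\qquad\text{and}\qquad\limsup_{n\to\infty}\frac1n\sum_{k=1}^n a'_k(x)=\infty.$$ -/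

import Mathlib

open MeasureTheory Filter Set
open scoped Topology

noncomputable section

/-- The map `T_N` on `[0, 1)`: `T_N x = N / x - ⌊N / x⌋` for `x ≠ 0` and `T_N 0 = 0`. -/
def cfMap (N : ℤ) (x : ℝ) : ℝ :=
  if x = 0 then 0 else (N : ℝ) / x - (⌊(N : ℝ) / x⌋ : ℝ)

/-- The `k`-th digit (`k = 1, 2, …`) of the negative continued fraction expansion
`x = 1 - 1 / (a'₁ - 1 / (a'₂ - …))`, namely `a'_k = -⌊-1 / T_{-1}^{k-1} (1 - x)⌋`.
Only the indices `k ≥ 1` are meaningful. -/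
def negDigit (x : ℝ) (k : ℕ) : ℤ :=
  -⌊(-1 : ℝ) / ((cfMap (-1))^[k - 1] (1 - x))⌋

/-- The arithmetic mean `(1 / n) ∑_{k = 1}^n a'_k` of the first `n` negative continued fraction
digits of `x`. -/
def negDigitMean (n : ℕ) (x : ℝ) : ℝ :=
  (1 / (n : ℝ)) * ∑ k ∈ Finset.Icc 1 n, (negDigit x k : ℝ)

end

/-!
Let `x = [0; a₁, a₂, …]` be the regular continued fraction of an irrational `x ∈ (0, 1)`. The digits
of its negative continued fraction are `2, …, 2, a₂ + 2, 2, …, 2, a₄ + 2, …`, where the `j`-th block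
has length `a_{2j-1}` and ends in `a_{2j} + 2`. So with `N m = a₁ + a₃ + ⋯ + a_{2m-1}` and
`E m = a₂ + a₄ + ⋯ + a_{2m}`, the excess over `2 n` of the sum of the first `n` negative digits is
nondecreasing in `n` and equals `E m` for `N m ≤ n < N (m + 1)`
(`monotone_backwardSum_sub`, `backwardSum_digitSum`, `backwardSum_digitSum_succ_sub_one`): the mean
is `2 + E m / n`.

Under Lebesgue measure the regular digits are governed by a Markov chain of states `s ∈ [0, 1]`,
namely `s = q_{n-1} / q_n`. Given the first `n` digits, the point `gauss^[n] x` has the law with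
quantile function `u ↦ u / (1 + s - s u)` (`lintegral_word_gauss`), so that `a_{n+1} ≥ k` has
probability `(1 + s) / (k + s)`, and the next state is `1 / (a_{n+1} + s)`. The transition operator of
this chain reverses monotonicity and at least halves the oscillation of monotone functions
(`antitoneOn_transition`, `transition_zero_sub_one_le`), so the expected state converges to a constant
`c` exponentially fast and averages of states along any increasing sequence of indices concentrate
at `c`.

*Convergence in measure.* Truncating digits at `K m` and computing second moments gives a weak law
(`exists_tendsto_digitSum`): a sum of `m` digits along an increasing sequence of indices is
`(1 + c + o(1)) m log m` in probability. The normalization is the same for `N m` and `E m`, and it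
is regular enough in `m` to be compared with `n`, so `E m / n → 1` in measure for the `m` with
`N m ≤ n < N (m + 1)`, and the mean tends to `3`.

*Oscillation.* Given the past, `a_{n+1} ≥ M (r + a₁ + ⋯ + a_n)` has probability at least
`1 / (M (r + a₁ + ⋯ + a_n))`, and `a₁ + ⋯ + a_n` is at most a constant times `n log n` with
probability close to one. As `∑ 1 / (n log n)` diverges, almost surely this happens for some `n` of any
prescribed parity (`ae_exists_large_digit`). For a large `a_{2j}` the mean becomes arbitrarily large;
for a large `a_{2j+1}` it comes down to `2`. This rules out almost sure convergence to `3`.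
-/

noncomputable section

/-! ### Regular continued fraction digits and their Markov property -/

/-- The Gauss map `x ↦ 1 / x - ⌊1 / x⌋` of the regular continued fraction. -/
def gauss (x : ℝ) : ℝ := Int.fract x⁻¹

/-- The leading partial quotient `⌊1 / x⌋` of the regular continued fraction of `x`. The maximum
with `1` changes nothing for `x ∈ (0, 1]`; it makes all digits positive even where the expansion
of a rational number has stopped. -/
def leadDigit (x : ℝ) : ℕ := max 1 ⌊x⁻¹⌋₊

lemma one_le_leadDigit (x : ℝ) : 1 ≤ leadDigit x := le_max_left _ _

lemma leadDigit_eq_iff {x : ℝ} {k : ℕ} (hx : 1 ≤ x⁻¹) :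
    leadDigit x = k ↔ (k : ℝ) ≤ x⁻¹ ∧ x⁻¹ < k + 1 := by
  rw [leadDigit, max_eq_right (Nat.one_le_floor_iff _ |>.2 hx), Nat.floor_eq_iff (by linarith)]

lemma le_leadDigit_iff {x : ℝ} {k : ℕ} (hx : 1 ≤ x⁻¹) :
    k ≤ leadDigit x ↔ (k : ℝ) ≤ x⁻¹ := by
  rw [leadDigit, max_eq_right (Nat.one_le_floor_iff _ |>.2 hx), Nat.le_floor_iff (by linarith)]

/-- The regular continued fraction digits of `x = [0; a₁, a₂, …]`, indexed from `0`:
`digit j x = a_{j + 1}`. -/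
def digit (j : ℕ) (x : ℝ) : ℕ := leadDigit (gauss^[j] x)

/-- The word `[a₁, …, a_n]` of the first `n` regular continued fraction digits of `x`. -/
def word (n : ℕ) (x : ℝ) : List ℕ := (List.range n).map fun k => digit k x

/-- The state reached from `s` after reading the digits of `w`, each digit `a` moving `s` to
`1 / (a + s)`. From `s = 0` and `w = [a₁, …, a_n]` it is the ratio `q_{n-1} / q_n` of the
denominators of consecutive convergents. -/
def ratio (s : ℝ) (w : List ℕ) : ℝ := w.foldl (fun (t : ℝ) (a : ℕ) => ((a : ℝ) + t)⁻¹) s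

/-- The quantile function of the law on `(0, 1)` with density `t ↦ (1 + s) / (1 + s t) ^ 2`. -/
def quant (s u : ℝ) : ℝ := u / (1 + s - s * u)

lemma word_zero (x : ℝ) : word 0 x = [] := rfl

lemma word_succ (n : ℕ) (x : ℝ) : word (n + 1) x = word n x ++ [digit n x] := by
  simp [word, List.range_succ]

lemma word_succ' (n : ℕ) (x : ℝ) : word (n + 1) x = leadDigit x :: word n (gauss x) := by
  simp [word, List.range_succ_eq_map, digit, Function.comp_def]

lemma gauss_inv_add (k : ℕ) {t : ℝ} (ht : t ∈ Ico (0 : ℝ) 1) :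
    gauss (((k : ℝ) + 1 + t)⁻¹) = t := by
  have : (k : ℝ) + 1 + t = t + ((k + 1 : ℕ) : ℝ) := by push_cast; ring
  rw [gauss, inv_inv, this, Int.fract_add_natCast, Int.fract_eq_self]
  exact ht

lemma leadDigit_inv_add (k : ℕ) {t : ℝ} (ht : t ∈ Ico (0 : ℝ) 1) :
    leadDigit (((k : ℝ) + 1 + t)⁻¹) = k + 1 := by
  have hk : (0 : ℝ) ≤ k := k.cast_nonneg
  rw [leadDigit_eq_iff (by rw [inv_inv]; linarith [ht.1]), inv_inv]
  push_cast
  constructor <;> linarith [ht.1, ht.2]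

lemma quant_mem {s u : ℝ} (hs : 0 ≤ s) (hu : u ∈ Ioo (0 : ℝ) 1) : quant s u ∈ Ioo (0 : ℝ) 1 := by
  obtain ⟨h0, h1⟩ := hu
  have : 0 ≤ s * (1 - u) := mul_nonneg hs (by linarith)
  have hd : 0 < 1 + s - s * u := by linarith
  exact ⟨div_pos h0 hd, (div_lt_one hd).2 (by linarith)⟩

lemma quant_zero (u : ℝ) : quant 0 u = u := by simp [quant]

lemma inv_quant (s : ℝ) {u : ℝ} (hu : u ≠ 0) : (quant s u)⁻¹ = (1 + s) / u - s := by
  rw [quant, inv_div, sub_div, mul_div_cancel_right₀ _ hu]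

lemma measurable_quant (s : ℝ) : Measurable (quant s) := by
  unfold quant; fun_prop

/-- The `k`-th interval consists of the quantiles at which the leading digit is `k + 1`. -/
lemma iUnion_Ioc_quantile {s : ℝ} (hs : 0 ≤ s) :
    ⋃ k : ℕ, Ioc ((1 + s) / ((k : ℝ) + 2 + s)) ((1 + s) / ((k : ℝ) + 1 + s)) = Ioc 0 1 := by
  ext u
  simp only [mem_iUnion, mem_Ioc]
  constructor
  · rintro ⟨k, h1, h2⟩
    refine ⟨lt_trans (by positivity) h1, h2.trans ?_⟩
    rw [div_le_one (by positivity)]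
    linarith [k.cast_nonneg (α := ℝ)]
  · rintro ⟨h0, h1⟩
    have hge : 1 ≤ (1 + s) / u - s := by
      have : 1 + s ≤ (1 + s) / u := by
        rw [le_div_iff₀ h0]; nlinarith
      linarith
    have hfl : 1 ≤ ⌊(1 + s) / u - s⌋₊ := Nat.one_le_floor_iff _ |>.2 hge
    refine ⟨⌊(1 + s) / u - s⌋₊ - 1, ?_, ?_⟩
    · rw [Nat.cast_sub hfl, div_lt_comm₀ (by push_cast; linarith [Nat.one_le_cast (α := ℝ).2 hfl]) h0]
      have := Nat.lt_floor_add_one ((1 + s) / u - s)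
      push_cast; linarith
    · rw [Nat.cast_sub hfl, le_div_comm₀ h0 (by push_cast; linarith [Nat.one_le_cast (α := ℝ).2 hfl])]
      have := Nat.floor_le (a := (1 + s) / u - s) (by linarith)
      push_cast; linarith

lemma pairwise_disjoint_Ioc_quantile {s : ℝ} (hs : 0 ≤ s) :
    Pairwise (Function.onFun Disjoint
      fun k : ℕ => Ioc ((1 + s) / ((k : ℝ) + 2 + s)) ((1 + s) / ((k : ℝ) + 1 + s))) := by
  have hanti : Antitone fun k : ℕ => (1 + s) / ((k : ℝ) + 1 + s) := by
    intro a b hab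
    have : (a : ℝ) ≤ b := by exact_mod_cast hab
    dsimp only
    gcongr
  convert hanti.pairwise_disjoint_on_Ioc_succ using 6
  simp [Order.succ_eq_add_one]; ring

/-- One step of the Markov chain of states: if `x` has law `quant s`, then its leading digit is
`k + 1` with probability `(1 + s) / ((k + 1 + s) (k + 2 + s))`, and given that, `gauss x` has law
`quant (1 / (k + 1 + s))`. In terms of quantiles the substitution is affine on each piece. -/
lemma lintegral_quant {s : ℝ} (hs : 0 ≤ s) (f : ℝ → ENNReal) :
    ∫⁻ u in Ioo 0 1, f (quant s u) =
      ∑' k : ℕ, ENNReal.ofReal ((1 + s) / (((k : ℝ) + 1 + s) * ((k : ℝ) + 2 + s))) *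
        ∫⁻ v in Ioo 0 1, f (((k : ℝ) + 1 + quant (((k : ℝ) + 1 + s)⁻¹) v)⁻¹) := by
  rw [setLIntegral_congr Ioo_ae_eq_Ioc, ← iUnion_Ioc_quantile hs,
    lintegral_iUnion (fun _ => measurableSet_Ioc) (pairwise_disjoint_Ioc_quantile hs)]
  congr 1
  ext k
  set p := (1 + s) / (((k : ℝ) + 1 + s) * ((k : ℝ) + 2 + s)) with hp
  have hk : (0 : ℝ) ≤ k := k.cast_nonneg
  have hp0 : 0 < p := by positivity
  have himg : (fun v => (1 + s) / ((k : ℝ) + 1 + s) + -p * v) '' Ioo 0 1 =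
      Ioo ((1 + s) / ((k : ℝ) + 2 + s)) ((1 + s) / ((k : ℝ) + 1 + s)) := by
    have hlin : (1 + s) / ((k : ℝ) + 1 + s) - p = (1 + s) / ((k : ℝ) + 2 + s) := by
      rw [hp]; field_simp; ring
    ext u
    simp only [mem_image, mem_Ioo]
    constructor
    · rintro ⟨v, ⟨h0, h1⟩, rfl⟩
      constructor <;> nlinarith
    · rintro ⟨h0, h1⟩
      refine ⟨((1 + s) / ((k : ℝ) + 1 + s) - u) / p, ⟨div_pos (by linarith) hp0, ?_⟩, ?_⟩
      · rw [div_lt_one hp0]; linarith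
      · field_simp; ring
  rw [← restrict_Ioo_eq_restrict_Ioc, ← himg,
    lintegral_image_eq_lintegral_abs_deriv_mul (f' := fun _ => -p) measurableSet_Ioo
      (fun v _ => ((hasDerivAt_const_mul (-p)).const_add _).hasDerivWithinAt)
      (fun a _ b _ h => by
        have : -p * a = -p * b := by simpa using h
        exact mul_left_cancel₀ (neg_ne_zero.2 hp0.ne') this)]
  rw [abs_neg, abs_of_pos hp0, lintegral_const_mul' _ _ ENNReal.ofReal_ne_top]
  congr 1
  refine setLIntegral_congr_fun measurableSet_Ioo fun v hv => ?_
  have h1 : 0 < (k : ℝ) + 2 + s - v := by linarith [hv.2]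
  have hu : (1 + s) / ((k : ℝ) + 1 + s) + -p * v =
      (1 + s) * ((k : ℝ) + 2 + s - v) / (((k : ℝ) + 1 + s) * ((k : ℝ) + 2 + s)) := by
    rw [hp]; field_simp; ring
  have hpos : 0 < (1 + s) / ((k : ℝ) + 1 + s) + -p * v := by rw [hu]; positivity
  have hq : quant (((k : ℝ) + 1 + s)⁻¹) v = v * ((k : ℝ) + 1 + s) / ((k : ℝ) + 2 + s - v) := by
    rw [quant]
    rw [show 1 + ((k : ℝ) + 1 + s)⁻¹ - ((k : ℝ) + 1 + s)⁻¹ * v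
      = ((k : ℝ) + 2 + s - v) / ((k : ℝ) + 1 + s) by field_simp; ring]
    field_simp
  rw [← inv_inv (quant s _), inv_quant s hpos.ne', hq, hu]
  congr 2
  field_simp
  ring

/-- The Markov property: given the first `n` digits of a point with law `quant s`, its image under
the `n`-th iterate of the Gauss map has law `quant (ratio s w)`, where `w` is the word of those
digits. -/
lemma lintegral_word_gauss (n : ℕ) {s : ℝ} (hs : 0 ≤ s) (Φ : List ℕ → ℝ → ENNReal) :
    ∫⁻ u in Ioo 0 1, Φ (word n (quant s u)) (gauss^[n] (quant s u)) =
      ∫⁻ u in Ioo 0 1, ∫⁻ v in Ioo 0 1,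
        Φ (word n (quant s u)) (quant (ratio s (word n (quant s u))) v) := by
  induction n generalizing s Φ with
  | zero => simp [word_zero, ratio]
  | succ n ih =>
    rw [lintegral_quant hs (fun x => Φ (word (n + 1) x) (gauss^[n + 1] x)),
      lintegral_quant hs (fun x => ∫⁻ v in Ioo 0 1,
        Φ (word (n + 1) x) (quant (ratio s (word (n + 1) x)) v))]
    congr 1
    ext k
    congr 1
    have hk : 0 ≤ ((k : ℝ) + 1 + s)⁻¹ := by positivity
    have key : ∀ v ∈ Ioo (0 : ℝ) 1, ∀ t, t = quant (((k : ℝ) + 1 + s)⁻¹) v →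
        leadDigit (((k : ℝ) + 1 + t)⁻¹) = k + 1 ∧ gauss (((k : ℝ) + 1 + t)⁻¹) = t := by
      rintro v hv t rfl
      have := Ioo_subset_Ico_self (quant_mem hk hv)
      exact ⟨leadDigit_inv_add k this, gauss_inv_add k this⟩
    refine Eq.trans ?_ ((ih hk fun w => Φ ((k + 1) :: w)).trans ?_)
    · refine setLIntegral_congr_fun measurableSet_Ioo fun v hv => ?_
      obtain ⟨h1, h2⟩ := key v hv _ rfl
      simp only [word_succ', h1, h2, Function.iterate_succ_apply]
    · refine setLIntegral_congr_fun measurableSet_Ioo fun v hv => ?_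
      obtain ⟨h1, h2⟩ := key v hv _ rfl
      simp only [word_succ', h1, h2, ratio, List.foldl_cons]
      push_cast
      rfl

/-! ### The unit interval and the states of the chain -/

/-- Lebesgue measure on the unit interval, as a probability measure on `ℝ`. -/
abbrev unif : Measure ℝ := volume.restrict (Ioo 0 1)

instance : IsProbabilityMeasure unif := ⟨by simp⟩

/-- The state of the Markov chain after `n` digits of `x`, that is `q_{n-1} / q_n`. -/
def state (n : ℕ) (x : ℝ) : ℝ := ratio 0 (word n x)

lemma state_zero (x : ℝ) : state 0 x = 0 := rfl

lemma state_succ (n : ℕ) (x : ℝ) : state (n + 1) x = ((digit n x : ℝ) + state n x)⁻¹ := by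
  simp [state, word_succ, ratio]

lemma one_le_digit (n : ℕ) (x : ℝ) : 1 ≤ digit n x := one_le_leadDigit _

lemma inv_add_mem {a : ℕ} (ha : 1 ≤ a) {s : ℝ} (hs : s ∈ Icc (0 : ℝ) 1) :
    ((a : ℝ) + s)⁻¹ ∈ Icc (0 : ℝ) 1 := by
  have ha : (1 : ℝ) ≤ a := by exact_mod_cast ha
  exact ⟨inv_nonneg.2 (by linarith [hs.1]), inv_le_one_of_one_le₀ (by linarith [hs.1])⟩

lemma state_mem (n : ℕ) (x : ℝ) : state n x ∈ Icc (0 : ℝ) 1 := by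
  induction n with
  | zero => simp [state_zero]
  | succ n ih => rw [state_succ]; exact inv_add_mem (one_le_digit n x) ih

/-! ### Functions of finitely many digits -/

lemma measurable_gauss : Measurable gauss := by unfold gauss; fun_prop

lemma measurable_leadDigit : Measurable leadDigit := by unfold leadDigit; fun_prop

lemma measurable_digit (n : ℕ) : Measurable (digit n) :=
  measurable_leadDigit.comp (measurable_gauss.iterate n)

lemma word_eq_ofFn (n : ℕ) (x : ℝ) : word n x = List.ofFn fun k : Fin n => digit k x := by
  rw [word, List.ofFn_eq_map, List.map_eq_map_iff.2 fun _ _ => rfl, ← List.map_coe_finRange_eq_range,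
    List.map_map]
  rfl

lemma measurable_digits (n : ℕ) : Measurable fun x => fun k : Fin n => digit k x :=
  measurable_pi_lambda _ fun k => measurable_digit k

lemma measurable_of_factorsThrough {β : Type*} [MeasurableSpace β] [Nonempty β] {n : ℕ} {Z : ℝ → β}
    (hZ : Z.FactorsThrough (word n)) : Measurable Z := by
  obtain ⟨ζ, rfl⟩ := (Function.factorsThrough_iff _).1 hZ
  have : ζ ∘ word n = (fun p => ζ (List.ofFn p)) ∘ fun x => fun k : Fin n => digit k x := by
    ext x; simp [word_eq_ofFn]
  rw [this]
  exact (measurable_of_countable _).comp (measurable_digits n)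

lemma factorsThrough_word_mono {β : Type*} {n m : ℕ} (hnm : n ≤ m) {Z : ℝ → β}
    (hZ : Z.FactorsThrough (word n)) : Z.FactorsThrough (word m) := by
  intro x y h
  apply hZ
  obtain ⟨k, rfl⟩ := Nat.exists_eq_add_of_le hnm
  have := congrArg (List.take n) h
  simpa [word, ← List.map_take, List.take_range] using this

lemma factorsThrough_digit (n : ℕ) : (digit n).FactorsThrough (word (n + 1)) := by
  intro x y h
  rw [word_succ, word_succ] at h
  simpa using (List.append_inj' h rfl).2

lemma factorsThrough_state (n : ℕ) : (state n).FactorsThrough (word n) := by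
  intro x y h
  simp only [state, h]

lemma measurable_state (n : ℕ) : Measurable (state n) :=
  measurable_of_factorsThrough (factorsThrough_state n)

/-! ### The Markov property for real functions -/

lemma integrable_unif_of_bound {f : ℝ → ℝ} (hf : Measurable f) {C : ℝ} (hC : ∀ x, |f x| ≤ C) :
    Integrable f unif :=
  Integrable.of_bound hf.aestronglyMeasurable C (.of_forall hC)

lemma measurable_markov {n : ℕ} {Ψ : ℝ → ℝ → ℝ} (hΨ : Ψ.FactorsThrough (word n))
    (hm : ∀ x, Measurable (Ψ x)) : Measurable fun x => Ψ x (gauss^[n] x) := by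
  classical
  obtain ⟨ψ, rfl⟩ := (Function.factorsThrough_iff _).1 hΨ
  have h1 : Measurable fun p : (Fin n → ℕ) × ℝ =>
      if List.ofFn p.1 ∈ range (word n) then ψ (List.ofFn p.1) p.2 else 0 := by
    refine measurable_from_prod_countable_right fun p => ?_
    dsimp only
    split_ifs with h
    · obtain ⟨x, hx⟩ := h
      rw [← hx]
      exact hm x
    · exact measurable_const
  have h2 := h1.comp ((measurable_digits n).prodMk (measurable_gauss.iterate n))
  convert h2 using 1
  ext x
  simp [← word_eq_ofFn]

lemma measurable_markov_integral {n : ℕ} {Ψ : ℝ → ℝ → ℝ} (hΨ : Ψ.FactorsThrough (word n)) :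
    Measurable fun x => ∫ v, Ψ x (quant (state n x) v) ∂unif :=
  measurable_of_factorsThrough (n := n) fun x y h => by simp only [hΨ h, factorsThrough_state n h]

lemma integral_markov_of_nonneg {n : ℕ} {Ψ : ℝ → ℝ → ℝ} (hΨ : Ψ.FactorsThrough (word n))
    (hm : ∀ x, Measurable (Ψ x)) (h0 : ∀ x t, 0 ≤ Ψ x t) {C : ℝ} (hC : ∀ x t, Ψ x t ≤ C) :
    ∫ x, Ψ x (gauss^[n] x) ∂unif = ∫ x, ∫ v, Ψ x (quant (state n x) v) ∂unif ∂unif := by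
  rw [integral_eq_lintegral_of_nonneg_ae (.of_forall fun x => h0 _ _)
      (measurable_markov hΨ hm).aestronglyMeasurable,
    integral_eq_lintegral_of_nonneg_ae (.of_forall fun x => integral_nonneg fun v => h0 _ _)
      (measurable_markov_integral hΨ).aestronglyMeasurable]
  congr 1
  obtain ⟨ψ, rfl⟩ := (Function.factorsThrough_iff _).1 hΨ
  have key := lintegral_word_gauss n le_rfl fun w t => ENNReal.ofReal (ψ w t)
  simp only [quant_zero] at key
  simp only [Function.comp_apply]
  rw [key]
  refine lintegral_congr fun x => ?_
  refine (ofReal_integral_eq_lintegral_ofReal (integrable_unif_of_bound (C := C)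
    ((hm x).comp (measurable_quant _)) fun v => ?_) (.of_forall fun v => h0 _ _)).symm
  exact (abs_of_nonneg (h0 x _)).trans_le (hC x _)

/-- The Markov property `lintegral_word_gauss` for bounded real functions `Ψ x t`, where `Ψ x`
depends on `x` only through its first `n` digits. -/
lemma integral_markov {n : ℕ} {Ψ : ℝ → ℝ → ℝ} (hΨ : Ψ.FactorsThrough (word n))
    (hm : ∀ x, Measurable (Ψ x)) {C : ℝ} (hC : ∀ x t, |Ψ x t| ≤ C) :
    ∫ x, Ψ x (gauss^[n] x) ∂unif = ∫ x, ∫ v, Ψ x (quant (state n x) v) ∂unif ∂unif := by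
  have hi : ∀ x, Integrable (fun v => Ψ x (quant (state n x) v)) unif := fun x =>
    integrable_unif_of_bound (C := C) (f := fun v => Ψ x (quant (state n x) v))
      ((hm x).comp (measurable_quant _)) fun v => hC x _
  have key := integral_markov_of_nonneg (n := n) (Ψ := fun x t => Ψ x t + C) (C := C + C)
    (fun x y h => by simp only [hΨ h]) (fun x => (hm x).add_const C)
    (fun x t => by linarith [neg_le_of_abs_le (hC x t)])
    (fun x t => by linarith [le_of_abs_le (hC x t)])
  rw [integral_add (integrable_unif_of_bound (measurable_markov hΨ hm) fun x => hC x _)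
    (integrable_const C)] at key
  simp_rw [integral_add (hi _) (integrable_const C)] at key
  rw [integral_add (integrable_unif_of_bound (measurable_markov_integral hΨ) (C := C) fun x => ?_)
    (integrable_const _)] at key
  · simpa using key
  · simpa using norm_integral_le_of_norm_le_const (μ := unif)
      (f := fun v => Ψ x (quant (state n x) v)) (.of_forall fun v => hC x _)

lemma one_le_inv_quant {s v : ℝ} (hs : 0 ≤ s) (hv : v ∈ Ioo (0 : ℝ) 1) : 1 ≤ (quant s v)⁻¹ :=
  (one_le_inv₀ (quant_mem hs hv).1).2 (quant_mem hs hv).2.le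

/-- Given the past, `a_{n+1} ≥ j` has probability `(1 + s) / (j + s)`, where `s` is the current
state. -/
lemma integral_mul_tail {n : ℕ} {Z : ℝ → ℝ} (hZ : Z.FactorsThrough (word n)) {C : ℝ}
    (hC : ∀ x, |Z x| ≤ C) {J : ℝ → ℕ} (hJ : J.FactorsThrough (word n)) (hJ1 : ∀ x, 1 ≤ J x) :
    ∫ x, Z x * {x | J x ≤ digit n x}.indicator 1 x ∂unif =
      ∫ x, Z x * ((1 + state n x) / (J x + state n x)) ∂unif := by
  have key := integral_markov (n := n)
    (Ψ := fun x t => Z x * {t | J x ≤ leadDigit t}.indicator 1 t) (C := C)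
    (fun x y h => by simp only [hZ h, hJ h])
    (fun x => measurable_const.mul
      (measurable_one.indicator (measurableSet_le measurable_const measurable_leadDigit)))
    (fun x t => by
      rw [abs_mul]
      refine (mul_le_of_le_one_right (abs_nonneg _) ?_).trans (hC x)
      by_cases h : J x ≤ leadDigit t <;> simp [indicator, h])
  refine Eq.trans ?_ (key.trans ?_)
  · rfl
  refine integral_congr_ae (.of_forall fun x => ?_)
  dsimp only
  rw [integral_const_mul]
  congr 1
  obtain ⟨hs0, hs1⟩ := state_mem n x
  have hJ1' : (1 : ℝ) ≤ J x := by exact_mod_cast hJ1 x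
  set s := state n x
  have hle : (1 + s) / (J x + s) ≤ 1 := by
    rw [div_le_one (by linarith)]; linarith
  calc ∫ v, {t | J x ≤ leadDigit t}.indicator 1 (quant s v) ∂unif
      = ∫ v in Ioo 0 1, (Iic ((1 + s) / (J x + s))).indicator (1 : ℝ → ℝ) v := by
        refine setIntegral_congr_fun measurableSet_Ioo fun v hv => ?_
        have hiff : J x ≤ leadDigit (quant s v) ↔ v ≤ (1 + s) / (J x + s) := by
          rw [le_leadDigit_iff (one_le_inv_quant hs0 hv), inv_quant s hv.1.ne',
            le_sub_iff_add_le, le_div_comm₀ (by linarith) hv.1]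
        simp only [indicator, mem_ofPred_eq, mem_Iic, hiff, Pi.one_apply]
    _ = (1 + s) / (J x + s) := by
        have hset : Iic ((1 + s) / (J x + s)) ∩ Ioc 0 1 = Ioc 0 ((1 + s) / (J x + s)) := by
          ext v; simp only [mem_inter_iff, mem_Iic, mem_Ioc]
          exact ⟨fun h => ⟨h.2.1, h.1⟩, fun h => ⟨h.2, h.1, h.2.trans hle⟩⟩
        rw [integral_indicator_one measurableSet_Iic, restrict_Ioo_eq_restrict_Ioc,
          measureReal_restrict_apply measurableSet_Iic, hset, Real.volume_real_Ioc_of_le (by positivity),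
          sub_zero]

/-! ### The transition operator of the states -/

/-- The transition operator of the Markov chain of states: `transition h s` is the mean of `h` at
the state that follows `s`. -/
def transition (h : ℝ → ℝ) (s : ℝ) : ℝ :=
  ∫ v, h (((leadDigit (quant s v) : ℝ) + s)⁻¹) ∂unif

lemma integral_mul_transition {n : ℕ} {Z : ℝ → ℝ} (hZ : Z.FactorsThrough (word n)) {C : ℝ}
    (hC : ∀ x, |Z x| ≤ C) {h : ℝ → ℝ} {C' : ℝ} (hh : ∀ s ∈ Icc (0 : ℝ) 1, |h s| ≤ C') :
    ∫ x, Z x * h (state (n + 1) x) ∂unif = ∫ x, Z x * transition h (state n x) ∂unif := by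
  have key := integral_markov (n := n)
    (Ψ := fun x t => Z x * h (((leadDigit t : ℝ) + state n x)⁻¹)) (C := C * C')
    (fun x y h => by simp only [hZ h, factorsThrough_state n h])
    (fun x => measurable_const.mul
      ((measurable_of_countable fun a : ℕ => h (((a : ℝ) + state n x)⁻¹)).comp measurable_leadDigit))
    (fun x t => by
      rw [abs_mul]
      exact mul_le_mul (hC x) (hh _ (inv_add_mem (one_le_leadDigit t) (state_mem n x)))
        (abs_nonneg _) ((abs_nonneg _).trans (hC x)))
  simp only [state_succ, transition, ← integral_const_mul]
  exact key

lemma integrable_transition {h : ℝ → ℝ} {C : ℝ} (hh : ∀ s ∈ Icc (0 : ℝ) 1, |h s| ≤ C) {s : ℝ}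
    (hs : s ∈ Icc (0 : ℝ) 1) :
    Integrable (fun v => h (((leadDigit (quant s v) : ℝ) + s)⁻¹)) unif :=
  integrable_unif_of_bound ((measurable_of_countable fun a : ℕ => h (((a : ℝ) + s)⁻¹)).comp
    (measurable_leadDigit.comp (measurable_quant s)))
    fun _ => hh _ (inv_add_mem (one_le_leadDigit _) hs)

lemma transition_mem {h : ℝ → ℝ} (hh : MonotoneOn h (Icc 0 1)) {s : ℝ} (hs : s ∈ Icc (0 : ℝ) 1) :
    transition h s ∈ Icc (h 0) (h 1) := by
  have hb : ∀ v, h (((leadDigit (quant s v) : ℝ) + s)⁻¹) ∈ Icc (h 0) (h 1) := fun v => by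
    have := inv_add_mem (one_le_leadDigit (quant s v)) hs
    exact ⟨hh (by simp) this this.1, hh this (by simp) this.2⟩
  have hi := integrable_transition (h := h) (C := max |h 0| |h 1|) (fun t ht =>
    abs_le_max_abs_abs (hh (by simp) ht ht.1) (hh ht (by simp) ht.2)) hs
  constructor
  · simpa [transition] using integral_mono (integrable_const (h 0)) hi fun v => (hb v).1
  · simpa [transition] using integral_mono hi (integrable_const (h 1)) fun v => (hb v).2

lemma antitoneOn_transition {h : ℝ → ℝ} (hh : MonotoneOn h (Icc 0 1)) :
    AntitoneOn (transition h) (Icc 0 1) := by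
  have hC : ∀ t ∈ Icc (0 : ℝ) 1, |h t| ≤ max |h 0| |h 1| := fun t ht =>
    abs_le_max_abs_abs (hh (by simp) ht ht.1) (hh ht (by simp) ht.2)
  intro s hs t ht hst
  refine setIntegral_mono_on (integrable_transition hC ht) (integrable_transition hC hs)
    measurableSet_Ioo fun v hv => ?_
  refine hh (inv_add_mem (one_le_leadDigit _) ht) (inv_add_mem (one_le_leadDigit _) hs) ?_
  have h1 : leadDigit (quant s v) ≤ leadDigit (quant t v) := by
    rw [le_leadDigit_iff (one_le_inv_quant ht.1 hv)]
    have h2 := (le_leadDigit_iff (one_le_inv_quant hs.1 hv)).1 le_rfl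
    refine h2.trans ?_
    rw [inv_quant s hv.1.ne', inv_quant t hv.1.ne']
    have : (t - s) ≤ (t - s) / v := by
      rw [le_div_iff₀ hv.1]; nlinarith [hv.2]
    have e : (1 + t) / v = (1 + s) / v + (t - s) / v := by ring
    linarith
  have h1' : (leadDigit (quant s v) : ℝ) ≤ leadDigit (quant t v) := by exact_mod_cast h1
  have : (1 : ℝ) ≤ leadDigit (quant s v) := by exact_mod_cast one_le_leadDigit _
  gcongr
  linarith [hs.1]

/-- The transition operator at least halves the oscillation of a monotone function. Indeed the
state after `1` has the law of `1 / ⌊1 / v⌋` for `v` uniform in `(0, 1 / 2)`, and the state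
after `0` has the law of `1 / ⌊1 / v⌋` for `v` uniform in `(0, 1)`, so they agree half of the
time. -/
lemma transition_zero_sub_one_le {h : ℝ → ℝ} (hh : MonotoneOn h (Icc 0 1)) :
    transition h 0 - transition h 1 ≤ (h 1 - h 0) / 2 := by
  set F : ℝ → ℝ := fun w => h ((leadDigit w : ℝ)⁻¹) with hF
  have hmem : ∀ w, ((leadDigit w : ℝ)⁻¹) ∈ Icc (0 : ℝ) 1 := fun w => by
    simpa using inv_add_mem (one_le_leadDigit w) (s := 0) (by simp)
  have hFm : Measurable F :=
    (measurable_of_countable fun a : ℕ => h ((a : ℝ)⁻¹)).comp measurable_leadDigit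
  have hFi : ∀ a b, IntervalIntegrable F volume a b := fun a b => by
    refine (intervalIntegrable_const (c := max |h 0| |h 1|)).mono_fun
      hFm.aestronglyMeasurable (.of_forall fun w => ?_)
    refine (abs_le_max_abs_abs (hh (by simp) (hmem w) (hmem w).1)
      (hh (hmem w) (by simp) (hmem w).2)).trans (le_abs_self _)
  have e0 : transition h 0 = ∫ v in (0 : ℝ)..1, F v := by
    simp only [transition, quant_zero, add_zero, hF]
    rw [intervalIntegral.integral_of_le zero_le_one, ← restrict_Ioo_eq_restrict_Ioc]
  have e1 : transition h 1 = 2 * ∫ v in (0 : ℝ)..(1 / 2), F v := by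
    have : ∫ v in (0 : ℝ)..1, F (v / 2) = 2 * ∫ v in (0 : ℝ)..(1 / 2), F v := by
      rw [intervalIntegral.integral_comp_div F two_ne_zero]; simp
    rw [← this, intervalIntegral.integral_of_le zero_le_one, ← restrict_Ioo_eq_restrict_Ioc]
    refine setIntegral_congr_fun measurableSet_Ioo fun v hv => ?_
    -- `1 / quant 1 v = 2 / v - 1`, so the next state `1 / (⌊2 / v - 1⌋ + 1)` is `1 / ⌊2 / v⌋`.
    have hd : leadDigit (v / 2) = leadDigit (quant 1 v) + 1 := by
      have h1 := one_le_inv_quant zero_le_one hv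
      have h2 := (leadDigit_eq_iff h1).1 rfl
      rw [inv_quant 1 hv.1.ne'] at h2 h1
      have : (v / 2)⁻¹ = (1 + 1) / v := by rw [inv_div]; norm_num
      rw [leadDigit_eq_iff (by rw [this]; linarith), this]
      push_cast
      constructor <;> linarith
    simp only [hF, hd]
    push_cast
    rfl
  have e2 : ∫ v in (1 / 2 : ℝ)..1, F v = h 1 / 2 := by
    have : ∫ v in (1 / 2 : ℝ)..1, F v = ∫ v in (1 / 2 : ℝ)..1, h 1 := by
      rw [intervalIntegral.integral_of_le (by norm_num), intervalIntegral.integral_of_le (by norm_num)]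
      refine setIntegral_congr_fun measurableSet_Ioc fun v hv => ?_
      have hv0 : 0 < v := by linarith [hv.1]
      have h1 : 1 ≤ v⁻¹ := (one_le_inv₀ hv0).2 hv.2
      have h2 : v⁻¹ < 2 := by rw [inv_lt_comm₀ hv0 two_pos]; linarith [hv.1]
      have : leadDigit v = 1 := by
        rw [leadDigit_eq_iff h1]; push_cast; constructor <;> linarith
      simp [hF, this]
    rw [this, intervalIntegral.integral_const]
    simp; ring
  have e3 : h 0 / 2 ≤ ∫ v in (0 : ℝ)..(1 / 2), F v := by
    have := intervalIntegral.integral_mono_on (a := 0) (b := 1 / 2) (f := fun _ => h 0) (g := F)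
      (by norm_num) intervalIntegrable_const (hFi _ _)
      fun v _ => hh (by simp) (hmem v) (hmem v).1
    rw [intervalIntegral.integral_const] at this
    simp only [smul_eq_mul] at this
    linarith
  rw [e0, e1, ← intervalIntegral.integral_add_adjacent_intervals (hFi 0 (1 / 2)) (hFi (1 / 2) 1), e2]
  linarith

lemma transition_neg (h : ℝ → ℝ) : transition (-h) = -transition h := by
  ext s; simp [transition, integral_neg]

/-- The operator `h ↦ -transition h` preserves monotonicity, which makes it more convenient to
iterate than `transition` itself. -/
lemma monotoneOn_iterate_neg_transition (n : ℕ) :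
    MonotoneOn ((fun h => -transition h)^[n] id) (Icc 0 1) ∧
      ((fun h => -transition h)^[n] id) 1 - ((fun h => -transition h)^[n] id) 0 ≤ (1 / 2) ^ n := by
  induction n with
  | zero => exact ⟨monotoneOn_id, by simp⟩
  | succ n ih =>
    rw [Function.iterate_succ_apply']
    refine ⟨(antitoneOn_transition ih.1).neg, ?_⟩
    have := transition_zero_sub_one_le ih.1
    simp only [Pi.neg_apply]
    rw [pow_succ]
    linarith [ih.2]

lemma iterate_neg_transition (n : ℕ) :
    (fun h => -transition h)^[n] id = (-1 : ℝ) ^ n • transition^[n] id := by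
  induction n with
  | zero => simp
  | succ n ih =>
    rw [Function.iterate_succ_apply', ih, Function.iterate_succ_apply']
    rcases neg_one_pow_eq_or ℝ n with h | h <;> rw [pow_succ, h] <;>
      simp [transition_neg]

lemma iterate_transition_nonneg (n : ℕ) {s : ℝ} (hs : s ∈ Icc (0 : ℝ) 1) :
    0 ≤ transition^[n] id s := by
  induction n generalizing s with
  | zero => exact hs.1
  | succ n ih =>
    rw [Function.iterate_succ_apply']
    exact integral_nonneg fun v => ih (inv_add_mem (one_le_leadDigit _) hs)

/-- The expected state after `n` steps converges exponentially fast, uniformly in the initial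
state. -/
lemma exists_abs_iterate_transition_sub_le :
    ∃ c : ℝ, 0 ≤ c ∧ ∀ n, ∀ s ∈ Icc (0 : ℝ) 1, |transition^[n] id s - c| ≤ 3 * (1 / 2) ^ n := by
  have h0 : (0 : ℝ) ∈ Icc (0 : ℝ) 1 := by simp
  have h1 : (1 : ℝ) ∈ Icc (0 : ℝ) 1 := by simp
  have hosc : ∀ n, ∀ s ∈ Icc (0 : ℝ) 1,
      |transition^[n] id s - transition^[n] id 0| ≤ (1 / 2) ^ n := by
    intro n s hs
    obtain ⟨hm, ho⟩ := monotoneOn_iterate_neg_transition n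
    have h := abs_le.2 ⟨by linarith [hm h0 hs hs.1, pow_pos (one_half_pos (α := ℝ)) n],
      (sub_le_sub_right (hm hs h1 hs.2) _).trans ho⟩
    rw [iterate_neg_transition] at h
    rcases neg_one_pow_eq_or ℝ n with e | e <;> simp only [e, one_smul, neg_smul, Pi.neg_apply] at h
    · exact h
    · rwa [neg_sub_neg, abs_sub_comm] at h
  have hstep : ∀ n, dist (transition^[n] id 0) (transition^[n + 1] id 0) ≤ 2 / 2 / 2 ^ n := by
    intro n
    obtain ⟨hm, ho⟩ := monotoneOn_iterate_neg_transition n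
    obtain ⟨h2, h3⟩ := transition_mem hm h0
    have h := abs_le.2 ⟨by linarith [pow_pos (one_half_pos (α := ℝ)) n],
      (sub_le_sub_right h3 _).trans ho⟩
    rw [iterate_neg_transition] at h
    rw [dist_comm, Real.dist_eq, Function.iterate_succ_apply', div_self two_ne_zero, ← one_div_pow]
    rcases neg_one_pow_eq_or ℝ n with e | e <;>
      simp only [e, one_smul, neg_smul, Pi.neg_apply, transition_neg] at h
    · exact h
    · rwa [neg_sub_neg, abs_sub_comm] at h
  obtain ⟨c, hc⟩ := cauchySeq_tendsto_of_complete (cauchySeq_of_le_geometric_two hstep)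
  refine ⟨c, ge_of_tendsto' hc fun n => iterate_transition_nonneg n h0, fun n s hs => ?_⟩
  have := dist_le_of_le_geometric_two_of_tendsto hstep hc n
  rw [Real.dist_eq] at this
  have e : (2 : ℝ) / 2 ^ n = 2 * (1 / 2) ^ n := by rw [one_div_pow]; ring
  rw [e] at this
  calc _ ≤ _ := abs_sub_le _ (transition^[n] id 0) c
    _ ≤ (1 / 2) ^ n + 2 * (1 / 2) ^ n := add_le_add (hosc n s hs) this
    _ = _ := by ring

/-! ### Truncated digits and variance bounds -/

/-- The digit `digit n x` truncated at `B`. -/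
def truncDigit (B n : ℕ) (x : ℝ) : ℝ := (min (digit n x) B : ℕ)

/-- The mean of a digit truncated at `B`, given that the current state is `s`. -/
def truncMean (B : ℕ) (s : ℝ) : ℝ := ∑ k ∈ Finset.range B, (1 + s) / ((k : ℝ) + 1 + s)

lemma truncDigit_eq_sum (B n : ℕ) (x : ℝ) :
    truncDigit B n x =
      ∑ k ∈ Finset.range B, {x | k + 1 ≤ digit n x}.indicator (1 : ℝ → ℝ) x := by
  have : ∑ k ∈ Finset.range B, {x | k + 1 ≤ digit n x}.indicator (1 : ℝ → ℝ) x =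
      ∑ k ∈ Finset.range B, if k < digit n x then 1 else 0 := by
    refine Finset.sum_congr rfl fun k _ => ?_
    simp [indicator]
  rw [this, Finset.sum_boole, truncDigit]
  congr 1
  rw [← Finset.card_range (min _ _)]
  congr 1
  ext k
  simp; tauto

lemma measurable_truncDigit (B n : ℕ) : Measurable (truncDigit B n) :=
  (measurable_of_countable fun a : ℕ => ((min a B : ℕ) : ℝ)).comp (measurable_digit n)

lemma factorsThrough_truncDigit (B n : ℕ) : (truncDigit B n).FactorsThrough (word (n + 1)) := by
  intro x y h
  simp only [truncDigit, factorsThrough_digit n h]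

lemma truncDigit_nonneg (B n : ℕ) (x : ℝ) : 0 ≤ truncDigit B n x := Nat.cast_nonneg _

lemma truncDigit_le (B n : ℕ) (x : ℝ) : truncDigit B n x ≤ B := by
  unfold truncDigit; exact_mod_cast min_le_right _ _

lemma measurableSet_le_digit (k n : ℕ) : MeasurableSet {x | k ≤ digit n x} :=
  measurableSet_le measurable_const (measurable_digit n)

lemma integrable_indicator_le_digit (k n : ℕ) :
    Integrable ({x | k ≤ digit n x}.indicator (1 : ℝ → ℝ)) unif :=
  (integrable_const (1 : ℝ)).indicator (measurableSet_le_digit k n)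

lemma abs_mul_indicator_le {C : ℝ} {z : ℝ} (hz : |z| ≤ C) (A : Set ℝ) (x : ℝ) :
    |z * A.indicator (1 : ℝ → ℝ) x| ≤ C := by
  have := (abs_nonneg z).trans hz
  by_cases h : x ∈ A <;> simp [h, hz, this]

lemma integral_mul_truncDigit {n : ℕ} {Z : ℝ → ℝ} (hZ : Z.FactorsThrough (word n)) {C : ℝ}
    (hC : ∀ x, |Z x| ≤ C) (B : ℕ) :
    ∫ x, Z x * truncDigit B n x ∂unif = ∫ x, Z x * truncMean B (state n x) ∂unif := by
  have hZm := measurable_of_factorsThrough hZ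
  simp only [truncDigit_eq_sum, truncMean, Finset.mul_sum]
  rw [integral_finsetSum, integral_finsetSum]
  · refine Finset.sum_congr rfl fun k _ => ?_
    simpa using integral_mul_tail hZ hC (J := fun _ => k + 1) (fun _ _ _ => rfl) (by simp)
  · intro k _
    refine integrable_unif_of_bound (C := C) (hZm.mul
      (measurable_const.add (measurable_state n) |>.div
        (measurable_const.add (measurable_state n)))) fun x => ?_
    obtain ⟨h0, h1⟩ := state_mem n x
    rw [abs_mul]
    refine (mul_le_of_le_one_right (abs_nonneg _) ?_).trans (hC x)
    rw [abs_of_nonneg (by positivity), div_le_one (by positivity)]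
    linarith [k.cast_nonneg (α := ℝ)]
  · intro k _
    exact integrable_unif_of_bound (C := C)
      (hZm.mul (measurable_one.indicator (measurableSet_le_digit _ _)))
      fun x => abs_mul_indicator_le (hC x) _ _

lemma measureReal_le_digit_le (n : ℕ) {k : ℕ} (hk : 1 ≤ k) :
    unif.real {x | k ≤ digit n x} ≤ 2 / k := by
  have key := integral_mul_tail (n := n) (Z := fun _ => 1) (C := 1) (fun _ _ _ => rfl) (by simp)
    (J := fun _ => k) (fun _ _ _ => rfl) (fun _ => hk)
  simp only [one_mul] at key
  rw [integral_indicator_one (measurableSet_le_digit k n)] at key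
  rw [key]
  have hk' : (1 : ℝ) ≤ k := by exact_mod_cast hk
  have hb : ∀ x, (1 + state n x) / (k + state n x) ≤ 2 / k := fun x => by
    obtain ⟨h0, h1⟩ := state_mem n x
    gcongr <;> linarith
  have h0 : ∀ x, 0 ≤ (1 + state n x) / (k + state n x) := fun x => by
    have := (state_mem n x).1
    positivity
  have := integral_mono (μ := unif) (integrable_unif_of_bound (C := 2 / k)
    ((measurable_const.add (measurable_state n)).div (measurable_const.add (measurable_state n)))
    fun x => by rw [Pi.div_apply, Pi.add_apply, Pi.add_apply, abs_of_nonneg (h0 x)]; exact hb x)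
    (integrable_const (2 / (k : ℝ))) hb
  simpa using this

lemma integral_truncDigit_le (B n : ℕ) :
    ∫ x, truncDigit B n x ∂unif ≤ 2 * ∑ k ∈ Finset.range B, ((k : ℝ) + 1)⁻¹ := by
  simp only [truncDigit_eq_sum]
  rw [integral_finsetSum _ fun k _ => integrable_indicator_le_digit (k + 1) n, Finset.mul_sum]
  refine Finset.sum_le_sum fun k _ => ?_
  refine (integral_indicator_one (measurableSet_le_digit (k + 1) n)).trans_le ?_
  refine (measureReal_le_digit_le n (by omega)).trans_eq ?_
  push_cast
  rfl

lemma integral_truncDigit_sq_le (B n : ℕ) : ∫ x, truncDigit B n x ^ 2 ∂unif ≤ 4 * B := by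
  have hsq : ∀ x, truncDigit B n x ^ 2 ≤
      ∑ k ∈ Finset.range B, (2 * ((k : ℝ) + 1)) * {x | k + 1 ≤ digit n x}.indicator (1 : ℝ → ℝ) x := by
    intro x
    have h1 : ∀ k ∈ Finset.range B,
        (2 * ((k : ℝ) + 1)) * {x | k + 1 ≤ digit n x}.indicator (1 : ℝ → ℝ) x =
          if k < digit n x then 2 * ((k : ℝ) + 1) else 0 := by
      intro k _
      simp [indicator]
    rw [Finset.sum_congr rfl h1, ← Finset.sum_filter]
    have h2 : {k ∈ Finset.range B | k < digit n x} = Finset.range (min (digit n x) B) := by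
      ext k; simp; tauto
    rw [h2, truncDigit]
    generalize min (digit n x) B = r
    induction r with
    | zero => simp
    | succ r ih => rw [Finset.sum_range_succ]; push_cast; nlinarith
  have hi : ∀ k : ℕ, Integrable (fun x =>
      (2 * ((k : ℝ) + 1)) * {x | k + 1 ≤ digit n x}.indicator (1 : ℝ → ℝ) x) unif := fun k =>
    (integrable_indicator_le_digit (k + 1) n).const_mul _
  calc ∫ x, truncDigit B n x ^ 2 ∂unif
      ≤ ∫ x, ∑ k ∈ Finset.range B,
          (2 * ((k : ℝ) + 1)) * {x | k + 1 ≤ digit n x}.indicator (1 : ℝ → ℝ) x ∂unif := by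
        refine integral_mono (integrable_unif_of_bound (C := (B : ℝ) ^ 2)
          ((measurable_truncDigit B n).pow_const 2) fun x => ?_)
          (integrable_finsetSum _ fun k _ => hi k) hsq
        rw [abs_of_nonneg (by positivity)]
        exact pow_le_pow_left₀ (truncDigit_nonneg _ _ _) (truncDigit_le _ _ _) 2
    _ = ∑ k ∈ Finset.range B, (2 * ((k : ℝ) + 1)) * unif.real {x | k + 1 ≤ digit n x} := by
        rw [integral_finsetSum _ fun k _ => hi k]
        refine Finset.sum_congr rfl fun k _ => ?_
        rw [integral_const_mul, integral_indicator_one (measurableSet_le_digit (k + 1) n)]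
    _ ≤ ∑ k ∈ Finset.range B, (4 : ℝ) := by
        refine Finset.sum_le_sum fun k _ => ?_
        have := measureReal_le_digit_le n (k := k + 1) (by omega)
        push_cast at this
        calc _ ≤ (2 * ((k : ℝ) + 1)) * (2 / ((k : ℝ) + 1)) := by gcongr
          _ = 4 := by field_simp; norm_num
    _ = 4 * B := by simp; ring

/-- Variance bound for partial sums whose increments are bounded in mean square and nearly
uncorrelated with the past. -/
lemma integral_sum_sq_le {Ω : Type*} [MeasurableSpace Ω] {μ : Measure Ω} [IsFiniteMeasure μ]
    {X : ℕ → Ω → ℝ} (hX : ∀ n, Measurable (X n)) {C : ℝ} (hC : ∀ n x, |X n x| ≤ C) {D V : ℝ}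
    (hD : ∀ n, ∫ x, (∑ i ∈ Finset.range n, X i x) * X n x ∂μ ≤ D)
    (hV : ∀ n, ∫ x, X n x ^ 2 ∂μ ≤ V) (n : ℕ) :
    ∫ x, (∑ i ∈ Finset.range n, X i x) ^ 2 ∂μ ≤ n * (2 * D + V) := by
  have hS : ∀ n, Measurable fun x => ∑ i ∈ Finset.range n, X i x := fun n =>
    Finset.measurable_fun_sum _ fun i _ => hX i
  have hSb : ∀ n x, |∑ i ∈ Finset.range n, X i x| ≤ n * C := fun n x => by
    refine (Finset.abs_sum_le_sum_abs _ _).trans ?_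
    simpa using Finset.sum_le_card_nsmul (Finset.range n) (fun i => |X i x|) C fun i _ => hC i x
  induction n with
  | zero => simp
  | succ n ih =>
    have h1 : ∀ x, (∑ i ∈ Finset.range (n + 1), X i x) ^ 2 =
        ((∑ i ∈ Finset.range n, X i x) ^ 2 + 2 * ((∑ i ∈ Finset.range n, X i x) * X n x)) +
          X n x ^ 2 := fun x => by rw [Finset.sum_range_succ]; ring
    have i1 : Integrable (fun x => (∑ i ∈ Finset.range n, X i x) ^ 2) μ :=
      .of_bound ((hS n).pow_const 2).aestronglyMeasurable ((n * C) ^ 2) (.of_forall fun x => by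
        rw [norm_pow]; exact pow_le_pow_left₀ (norm_nonneg _) (hSb n x) 2)
    have i2 : Integrable (fun x => 2 * ((∑ i ∈ Finset.range n, X i x) * X n x)) μ := by
      refine Integrable.const_mul ?_ 2
      refine .of_bound ((hS n).mul (hX n)).aestronglyMeasurable (n * C * C) (.of_forall fun x => ?_)
      rw [norm_mul, Real.norm_eq_abs, Real.norm_eq_abs]
      exact mul_le_mul (hSb n x) (hC n x) (abs_nonneg _) ((abs_nonneg _).trans (hSb n x))
    have i3 : Integrable (fun x => X n x ^ 2) μ :=
      .of_bound ((hX n).pow_const 2).aestronglyMeasurable (C ^ 2) (.of_forall fun x => by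
        rw [norm_pow]; exact pow_le_pow_left₀ (norm_nonneg _) (hC n x) 2)
    have h2 := integral_add (i1.add i2) i3
    simp only [Pi.add_apply] at h2
    simp_rw [h1]
    rw [h2, integral_add i1 i2, integral_const_mul]
    push_cast
    linarith [hD n, hV n]

lemma measureReal_le_abs_le {f : ℝ → ℝ} (hf : Measurable f) {C : ℝ} (hC : ∀ x, |f x| ≤ C)
    {a V : ℝ} (ha : 0 < a) (hV : ∫ x, f x ^ 2 ∂unif ≤ V) :
    unif.real {x | a ≤ |f x|} ≤ V / a ^ 2 := by
  have h := mul_meas_ge_le_integral_of_nonneg (μ := unif) (f := fun x => f x ^ 2)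
    (.of_forall fun x => sq_nonneg _) (integrable_unif_of_bound (hf.pow_const 2) (C := C ^ 2)
      fun x => by rw [abs_pow]; exact pow_le_pow_left₀ (abs_nonneg _) (hC x) 2) (a ^ 2)
  have e : {x | a ≤ |f x|} = {x | a ^ 2 ≤ f x ^ 2} := by
    ext x; simp only [mem_ofPred_eq]; rw [sq_le_sq, abs_of_pos ha]
  rw [e, le_div_iff₀ (by positivity), mul_comm]
  exact h.trans hV

lemma truncMean_nonneg (B : ℕ) {s : ℝ} (hs : 0 ≤ s) : 0 ≤ truncMean B s :=
  Finset.sum_nonneg fun k _ => by positivity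

lemma truncMean_le (B : ℕ) {s : ℝ} (hs : 0 ≤ s) : truncMean B s ≤ B := by
  refine (Finset.sum_le_card_nsmul _ _ 1 fun k _ => ?_).trans (by simp)
  rw [div_le_one (by positivity)]; linarith [k.cast_nonneg (α := ℝ)]

lemma measurable_truncMean_state (B n : ℕ) : Measurable fun x => truncMean B (state n x) :=
  measurable_of_factorsThrough (n := n) fun x y h => by simp only [factorsThrough_state n h]

lemma factorsThrough_sum {β : Type*} [AddCommMonoid β] {n m : ℕ} {X : ℕ → ℝ → β}
    (hX : ∀ i < m, (X i).FactorsThrough (word n)) :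
    (fun x => ∑ i ∈ Finset.range m, X i x).FactorsThrough (word n) := fun _ _ h =>
  Finset.sum_congr rfl fun i hi => hX i (Finset.mem_range.1 hi) h

/-- The truncated digits, centred by their conditional means, are orthogonal. -/
lemma integral_sum_truncDigit_sub_sq_le {φ : ℕ → ℕ} (hφ : StrictMono φ) (B m : ℕ) :
    ∫ x, (∑ i ∈ Finset.range m, (truncDigit B (φ i) x - truncMean B (state (φ i) x))) ^ 2 ∂unif ≤
      m * (4 * B) := by
  have hm : ∀ n, Measurable fun x => truncDigit B n x - truncMean B (state n x) := fun n =>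
    (measurable_truncDigit B n).sub (measurable_truncMean_state B n)
  have hb : ∀ n x, |truncDigit B n x - truncMean B (state n x)| ≤ B := fun n x => by
    have h1 := truncDigit_nonneg B n x
    have h2 := truncDigit_le B n x
    have h3 := truncMean_nonneg B (state_mem n x).1
    have h4 := truncMean_le B (state_mem n x).1
    rw [abs_le]; constructor <;> linarith
  have horth : ∀ (n : ℕ) (Z : ℝ → ℝ), Z.FactorsThrough (word n) → ∀ C, (∀ x, |Z x| ≤ C) →
      ∫ x, Z x * (truncDigit B n x - truncMean B (state n x)) ∂unif = 0 := by
    intro n Z hZ C hC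
    have hZm := measurable_of_factorsThrough hZ
    have hC0 := (abs_nonneg _).trans (hC 0)
    simp only [mul_sub]
    rw [integral_sub, integral_mul_truncDigit hZ hC, sub_self]
    · refine integrable_unif_of_bound (C := C * B) (hZm.mul (measurable_truncDigit B n)) fun x => ?_
      rw [abs_mul, abs_of_nonneg (truncDigit_nonneg B n x)]
      exact mul_le_mul (hC x) (truncDigit_le _ _ _) (truncDigit_nonneg _ _ _) hC0
    · refine integrable_unif_of_bound (C := C * B) (hZm.mul (measurable_truncMean_state B n))
        fun x => ?_
      have h3 := truncMean_nonneg B (state_mem n x).1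
      rw [abs_mul, abs_of_nonneg h3]
      exact mul_le_mul (hC x) (truncMean_le B (state_mem n x).1) h3 hC0
  have := integral_sum_sq_le (μ := unif) (fun i => hm (φ i)) (fun i x => hb (φ i) x)
    (D := 0) (V := 4 * B) (fun n => ?_) (fun n => ?_) m
  · simpa using this
  · refine (horth (φ n) _ (factorsThrough_sum fun i hi => ?_) (n * B) fun x => ?_).le
    · intro x y h
      have h1 := factorsThrough_word_mono (hφ hi) (factorsThrough_truncDigit B (φ i)) h
      have h2 := factorsThrough_word_mono (hφ hi).le (factorsThrough_state (φ i)) h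
      simp only [h1, h2]
    · refine (Finset.abs_sum_le_sum_abs _ _).trans ?_
      simpa using Finset.sum_le_card_nsmul (Finset.range n)
        (fun i => |truncDigit B (φ i) x - truncMean B (state (φ i) x)|) B fun i _ => hb (φ i) x
  · generalize φ n = n
    have h := horth n (fun x => truncMean B (state n x))
      (fun _ _ h => by simp only [factorsThrough_state n h]) B fun x => by
        rw [abs_of_nonneg (truncMean_nonneg B (state_mem n x).1)]
        exact truncMean_le B (state_mem n x).1
    have i1 : Integrable (fun x => truncDigit B n x ^ 2) unif := by
      refine integrable_unif_of_bound (C := (B : ℝ) ^ 2) ((measurable_truncDigit B n).pow_const 2)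
        fun x => ?_
      rw [abs_of_nonneg (by positivity)]
      exact pow_le_pow_left₀ (truncDigit_nonneg _ _ _) (truncDigit_le _ _ _) 2
    have i2 : Integrable (fun x => 2 * (truncMean B (state n x) *
        (truncDigit B n x - truncMean B (state n x)))) unif := by
      refine Integrable.const_mul (integrable_unif_of_bound (C := (B : ℝ) * B)
        ((measurable_truncMean_state B n).mul (hm n)) fun x => ?_) 2
      have h3 := truncMean_nonneg B (state_mem n x).1
      rw [Pi.mul_apply, abs_mul, abs_of_nonneg h3]
      exact mul_le_mul (truncMean_le B (state_mem n x).1) (hb n x) (abs_nonneg _) (by positivity)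
    -- The variance is at most the second moment: drop `truncMean ^ 2` and use orthogonality.
    calc ∫ x, (truncDigit B n x - truncMean B (state n x)) ^ 2 ∂unif
        ≤ ∫ x, truncDigit B n x ^ 2 - 2 * (truncMean B (state n x) *
            (truncDigit B n x - truncMean B (state n x))) ∂unif := by
          refine integral_mono (integrable_unif_of_bound (C := (B : ℝ) ^ 2) ((hm n).pow_const 2)
            fun x => ?_) (i1.sub i2) fun x => ?_
          · rw [abs_pow]; exact pow_le_pow_left₀ (abs_nonneg _) (hb n x) 2
          · dsimp only
            nlinarith [sq_nonneg (truncMean B (state n x))]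
      _ = ∫ x, truncDigit B n x ^ 2 ∂unif := by
          rw [integral_sub i1 i2, integral_const_mul, h]; simp
      _ ≤ 4 * B := integral_truncDigit_sq_le B n

/-- Decay of correlations: the state `m` steps after time `n` is nearly uncorrelated with every
function of the first `n` digits. -/
lemma abs_integral_mul_state_sub_le {c : ℝ}
    (hc : ∀ n, ∀ s ∈ Icc (0 : ℝ) 1, |transition^[n] id s - c| ≤ 3 * (1 / 2) ^ n)
    {n : ℕ} {Z : ℝ → ℝ} (hZ : Z.FactorsThrough (word n)) {C : ℝ} (hC : ∀ x, |Z x| ≤ C) (m : ℕ) :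
    |∫ x, Z x * (state (n + m) x - c) ∂unif| ≤ C * (3 * (1 / 2) ^ m) := by
  have hZm := measurable_of_factorsThrough hZ
  have hC0 := (abs_nonneg _).trans (hC 0)
  have hu : ∀ j, ∀ s ∈ Icc (0 : ℝ) 1, |transition^[j] id s| ≤ |c| + 3 := fun j s hs => by
    have h1 := hc j s hs
    have h2 : (1 / 2 : ℝ) ^ j ≤ 1 := pow_le_one₀ (by norm_num) (by norm_num)
    have h3 := abs_add_le (transition^[j] id s - c) c
    rw [sub_add_cancel] at h3
    linarith
  have hum : ∀ j i, Measurable fun x => transition^[j] id (state i x) := fun j i =>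
    measurable_of_factorsThrough (n := i) fun x y h => by simp only [factorsThrough_state i h]
  have hiter : ∀ m j, ∫ x, Z x * transition^[j] id (state (n + m) x) ∂unif =
      ∫ x, Z x * transition^[j + m] id (state n x) ∂unif := by
    intro m
    induction m with
    | zero => simp
    | succ m ih =>
      intro j
      rw [← add_assoc, integral_mul_transition (factorsThrough_word_mono (by omega) hZ) hC (hu j),
        ← Function.iterate_succ_apply' transition j, ih (j + 1)]
      rw [show j + 1 + m = j + (m + 1) by omega]
  have hZi : Integrable Z unif := integrable_unif_of_bound hZm hC
  have hprod : ∀ j i, Integrable (fun x => Z x * transition^[j] id (state i x)) unif := fun j i =>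
    integrable_unif_of_bound (C := C * (|c| + 3)) (hZm.mul (hum j i)) fun x => by
      rw [abs_mul]
      exact mul_le_mul (hC x) (hu j _ (state_mem i x)) (abs_nonneg _) hC0
  have e : ∫ x, Z x * (state (n + m) x - c) ∂unif =
      ∫ x, Z x * (transition^[m] id (state n x) - c) ∂unif := by
    simp only [mul_sub]
    have h0 := hprod 0 (n + m)
    have h := hiter m 0
    simp only [Function.iterate_zero, id, zero_add] at h0 h
    rw [integral_sub h0 (hZi.mul_const c), integral_sub (hprod m n) (hZi.mul_const c), h]
  rw [e]
  have := norm_integral_le_of_norm_le_const (μ := unif)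
    (f := fun x => Z x * (transition^[m] id (state n x) - c)) (C := C * (3 * (1 / 2) ^ m))
    (.of_forall fun x => by
      rw [norm_mul]
      exact mul_le_mul (hC x) (hc m _ (state_mem n x)) (norm_nonneg _) hC0)
  simpa using this

/-- The averages of the states along an increasing sequence of indices concentrate at `c`. -/
lemma integral_sum_state_sub_sq_le {c : ℝ}
    (hc : ∀ n, ∀ s ∈ Icc (0 : ℝ) 1, |transition^[n] id s - c| ≤ 3 * (1 / 2) ^ n)
    {φ : ℕ → ℕ} (hφ : StrictMono φ) (m : ℕ) :
    ∫ x, (∑ i ∈ Finset.range m, (state (φ i) x - c)) ^ 2 ∂unif ≤ m * 27 := by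
  have hm : ∀ n, Measurable fun x => state n x - c := fun n => (measurable_state n).sub_const c
  have hb : ∀ n x, |state n x - c| ≤ 3 := fun n x => by simpa using hc 0 _ (state_mem n x)
  have := integral_sum_sq_le (μ := unif) (fun i => hm (φ i)) (fun i x => hb (φ i) x)
    (D := 9) (V := 9) (fun n => ?_) (fun n => ?_) m
  · exact this.trans_eq (by norm_num)
  · simp only [Finset.sum_mul]
    have hi : ∀ i, Integrable (fun x => (state (φ i) x - c) * (state (φ n) x - c)) unif := fun i =>
      integrable_unif_of_bound (C := 3 * 3) ((hm _).mul (hm _)) fun x => by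
        rw [abs_mul]
        exact mul_le_mul (hb _ x) (hb _ x) (abs_nonneg _) (by norm_num)
    rw [integral_finsetSum _ fun i _ => hi i]
    have hterm : ∀ i ∈ Finset.range n,
        ∫ x, (state (φ i) x - c) * (state (φ n) x - c) ∂unif ≤ 9 * (1 / 2) ^ (n - i) := by
      intro i hi
      have hin : i < n := Finset.mem_range.1 hi
      have h1 : n - i ≤ φ n - φ i := by
        have : ∀ k, φ i + k ≤ φ (i + k) := fun k => by
          induction k with
          | zero => simp
          | succ k ih => have := hφ (Nat.lt_succ_self (i + k)); grind
        have := this (n - i)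
        rw [Nat.add_sub_cancel' hin.le] at this
        omega
      have h2 := abs_integral_mul_state_sub_le hc (n := φ i) (Z := fun x => state (φ i) x - c)
        (fun x y h => by simp only [factorsThrough_state _ h]) (hb (φ i)) (φ n - φ i)
      rw [Nat.add_sub_cancel' (hφ hin).le] at h2
      have h3 : (1 / 2 : ℝ) ^ (φ n - φ i) ≤ (1 / 2) ^ (n - i) :=
        pow_le_pow_of_le_one (by norm_num) (by norm_num) h1
      linarith [le_of_abs_le h2]
    refine (Finset.sum_le_sum hterm).trans ?_
    rw [← Finset.mul_sum]
    have hgeom : ∀ n : ℕ, ∑ i ∈ Finset.range n, (1 / 2 : ℝ) ^ (n - i) = 1 - (1 / 2) ^ n := by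
      intro n
      induction n with
      | zero => simp
      | succ n ih =>
        rw [Finset.sum_range_succ, Nat.add_sub_cancel_left]
        have : ∀ i ∈ Finset.range n, (1 / 2 : ℝ) ^ (n + 1 - i) = 1 / 2 * (1 / 2) ^ (n - i) := by
          intro i hi
          rw [Nat.succ_sub (Finset.mem_range.1 hi).le, pow_succ']
        rw [Finset.sum_congr rfl this, ← Finset.mul_sum, ih]
        ring
    rw [hgeom]
    linarith [pow_pos (one_half_pos (α := ℝ)) n]
  · have := norm_integral_le_of_norm_le_const (μ := unif)
      (f := fun x => (state (φ n) x - c) ^ 2) (C := 9) (.of_forall fun x => by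
        rw [norm_pow]
        exact (pow_le_pow_left₀ (norm_nonneg _) (hb (φ n) x) 2).trans (by norm_num))
    simpa using (le_abs_self _).trans this

/-! ### The weak law for regular continued fraction digits -/

/-- The sum of the first `m` digits along the sequence of indices `φ`. -/
def digitSum (φ : ℕ → ℕ) (m : ℕ) (x : ℝ) : ℕ := ∑ i ∈ Finset.range m, digit (φ i) x

lemma measurable_digitSum (φ : ℕ → ℕ) (m : ℕ) : Measurable (digitSum φ m) :=
  Finset.measurable_fun_sum _ fun i _ => measurable_digit (φ i)

lemma log_le_sum_inv (B : ℕ) : Real.log B ≤ ∑ k ∈ Finset.range B, ((k : ℝ) + 1)⁻¹ := by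
  rcases B.eq_zero_or_pos with rfl | hB
  · simp
  have h := log_add_one_le_harmonic B
  have e : ((harmonic B : ℚ) : ℝ) = ∑ k ∈ Finset.range B, ((k : ℝ) + 1)⁻¹ := by
    simp [harmonic]
  rw [← e]
  exact (Real.log_le_log (by exact_mod_cast hB) (by push_cast; linarith)).trans h

lemma sum_inv_le_one_add_log (B : ℕ) :
    ∑ k ∈ Finset.range B, ((k : ℝ) + 1)⁻¹ ≤ 1 + Real.log B := by
  have e : ((harmonic B : ℚ) : ℝ) = ∑ k ∈ Finset.range B, ((k : ℝ) + 1)⁻¹ := by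
    simp [harmonic]
  rw [← e]
  exact harmonic_le_one_add_log B

lemma abs_truncMean_sub_le (B : ℕ) {s : ℝ} (hs : s ∈ Icc (0 : ℝ) 1) :
    |truncMean B s - (1 + s) * ∑ k ∈ Finset.range B, ((k : ℝ) + 1)⁻¹| ≤ 2 := by
  obtain ⟨h0, h1⟩ := hs
  rw [truncMean, Finset.mul_sum, ← Finset.sum_sub_distrib]
  refine (Finset.abs_sum_le_sum_abs _ _).trans ?_
  have hterm : ∀ k ∈ Finset.range B,
      |(1 + s) / ((k : ℝ) + 1 + s) - (1 + s) * ((k : ℝ) + 1)⁻¹| ≤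
        2 * (((k : ℝ) + 1)⁻¹ - (((k + 1 : ℕ) : ℝ) + 1)⁻¹) := by
    intro k _
    have hk : (0 : ℝ) ≤ k := k.cast_nonneg
    have hle : ((k : ℝ) + 1 + s)⁻¹ ≤ ((k : ℝ) + 1)⁻¹ :=
      inv_anti₀ (by positivity) (by linarith)
    have hge : (((k + 1 : ℕ) : ℝ) + 1)⁻¹ ≤ ((k : ℝ) + 1 + s)⁻¹ := by
      refine inv_anti₀ (by positivity) ?_
      push_cast
      linarith
    rw [div_eq_mul_inv, ← mul_sub, abs_mul, abs_of_nonneg (by linarith), abs_sub_comm,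
      abs_of_nonneg (by linarith)]
    apply mul_le_mul <;> linarith
  refine (Finset.sum_le_sum hterm).trans ?_
  rw [← Finset.mul_sum, Finset.sum_range_sub' fun k : ℕ => ((k : ℝ) + 1)⁻¹]
  have : (0 : ℝ) ≤ ((B : ℝ) + 1)⁻¹ := by positivity
  simp only [Nat.cast_zero, zero_add, inv_one]
  linarith

lemma measureReal_exists_lt_digit_le (φ : ℕ → ℕ) (B m : ℕ) :
    unif.real {x | ∃ i < m, B < digit (φ i) x} ≤ m * (2 / ((B : ℝ) + 1)) := by
  have e : {x | ∃ i < m, B < digit (φ i) x} =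
      ⋃ i ∈ Finset.range m, {x | B + 1 ≤ digit (φ i) x} := by
    ext x; simp
  rw [e]
  refine (measureReal_biUnion_finset_le _ _).trans ?_
  refine (Finset.sum_le_card_nsmul _ _ (2 / ((B : ℝ) + 1)) fun i _ => ?_).trans (by simp)
  have := measureReal_le_digit_le (φ i) (k := B + 1) (by omega)
  exact_mod_cast this

lemma digitSum_eq_sum_truncDigit {φ : ℕ → ℕ} {B m : ℕ} {x : ℝ}
    (h : ∀ i < m, digit (φ i) x ≤ B) :
    (digitSum φ m x : ℝ) = ∑ i ∈ Finset.range m, truncDigit B (φ i) x := by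
  rw [digitSum, Nat.cast_sum]
  refine Finset.sum_congr rfl fun i hi => ?_
  rw [truncDigit, min_eq_left (h i (Finset.mem_range.1 hi))]

/-- The deterministic part of the weak law: where no digit exceeds the level `K m`, and both the
truncated digits and the states are close to their means, the sum of `m` digits is close to
`(1 + c) m log m`. -/
lemma abs_digitSum_sub_lt {φ : ℕ → ℕ} {K m : ℕ} {x c δ : ℝ} (hK : 1 ≤ K) (hm : 1 ≤ m) (hc : 0 ≤ c)
    (hlog : 1 + Real.log K ≤ Real.log m)
    (hδ : 2 + (1 + c) * (1 + Real.log K) ≤ δ / 4 * Real.log m)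
    (htrunc : ∀ i < m, digit (φ i) x ≤ K * m)
    (hM : |∑ i ∈ Finset.range m, (truncDigit (K * m) (φ i) x - truncMean (K * m) (state (φ i) x))| <
      δ / 4 * (m * Real.log m))
    (hA : |∑ i ∈ Finset.range m, (state (φ i) x - c)| < δ / 8 * m) :
    |(digitSum φ m x : ℝ) - (1 + c) * (m * Real.log m)| < δ * (m * Real.log m) := by
  set H : ℝ := ∑ k ∈ Finset.range (K * m), ((k : ℝ) + 1)⁻¹ with hH
  set M := ∑ i ∈ Finset.range m,
    (truncDigit (K * m) (φ i) x - truncMean (K * m) (state (φ i) x)) with hMdef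
  set A := ∑ i ∈ Finset.range m, (state (φ i) x - c) with hAdef
  have hm0 : (0 : ℝ) < m := by exact_mod_cast hm
  have hK0 : (0 : ℝ) < K := by exact_mod_cast hK
  have hKlog : 0 ≤ Real.log K := Real.log_nonneg (by exact_mod_cast hK)
  have hlogm : 0 < Real.log m := by linarith
  have hlogKm : Real.log ((K * m : ℕ) : ℝ) = Real.log K + Real.log m := by
    push_cast; exact Real.log_mul hK0.ne' hm0.ne'
  have hH1 : Real.log m ≤ H := by
    have := log_le_sum_inv (K * m); rw [hlogKm] at this; linarith
  have hH2 : H ≤ 1 + Real.log K + Real.log m := by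
    have := sum_inv_le_one_add_log (K * m); rw [hlogKm] at this; linarith
  set R := ∑ i ∈ Finset.range m, (truncMean (K * m) (state (φ i) x) - (1 + state (φ i) x) * H)
    with hR
  have hRb : |R| ≤ 2 * m := by
    refine (Finset.abs_sum_le_sum_abs _ _).trans ?_
    refine (Finset.sum_le_card_nsmul _ _ 2 fun i _ =>
      abs_truncMean_sub_le (K * m) (state_mem (φ i) x)).trans_eq ?_
    simp; ring
  have hdecomp : (digitSum φ m x : ℝ) - (1 + c) * (m * Real.log m) =
      M + R + A * H + (1 + c) * (H - Real.log m) * m := by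
    rw [digitSum_eq_sum_truncDigit htrunc, hMdef, hR, hAdef, Finset.sum_sub_distrib,
      Finset.sum_sub_distrib, Finset.sum_sub_distrib, ← Finset.sum_mul, Finset.sum_add_distrib]
    simp
    ring
  have hAH : |A * H| ≤ δ / 8 * m * (2 * Real.log m) := by
    rw [abs_mul, abs_of_nonneg (hlogm.le.trans hH1)]
    exact mul_le_mul hA.le (by linarith) (hlogm.le.trans hH1) ((abs_nonneg _).trans hA.le)
  have hlast : |(1 + c) * (H - Real.log m) * m| ≤ (1 + c) * (1 + Real.log K) * m := by
    rw [abs_of_nonneg (by have : 0 ≤ H - Real.log m := by linarith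
                          positivity)]
    gcongr
    linarith
  have hδm := mul_le_mul_of_nonneg_right hδ hm0.le
  rw [hdecomp]
  calc _ ≤ |M| + |R| + |A * H| + |(1 + c) * (H - Real.log m) * m| := by
        refine (abs_add_le _ _).trans (add_le_add_left ?_ _)
        exact (abs_add_le _ _).trans (add_le_add_left (abs_add_le _ _) _)
    _ < δ / 4 * (m * Real.log m) + 2 * m + δ / 8 * m * (2 * Real.log m) +
        (1 + c) * (1 + Real.log K) * m := by linarith
    _ ≤ δ * (m * Real.log m) := by
      have : 0 < δ / 4 * (m * Real.log m) := (abs_nonneg _).trans_lt hM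
      nlinarith

/-- The weak law of large numbers for the regular continued fraction digits along any strictly
increasing sequence of indices, with a normalization that does not depend on that sequence. -/
lemma exists_tendsto_digitSum : ∃ κ : ℝ, 0 < κ ∧ ∀ φ : ℕ → ℕ, StrictMono φ → ∀ δ : ℝ, 0 < δ →
    Tendsto (fun m : ℕ => unif.real {x | δ * (m * Real.log m) ≤
      |(digitSum φ m x : ℝ) - κ * (m * Real.log m)|}) atTop (𝓝 0) := by
  obtain ⟨c, hc0, hc⟩ := exists_abs_iterate_transition_sub_le
  refine ⟨1 + c, by linarith, fun φ hφ δ hδ => ?_⟩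
  have hlogm : Tendsto (fun m : ℕ => Real.log m) atTop atTop :=
    Real.tendsto_log_atTop.comp tendsto_natCast_atTop_atTop
  have hbound : ∀ K : ℕ, 1 ≤ K → ∀ᶠ m : ℕ in atTop, unif.real {x | δ * (m * Real.log m) ≤
      |(digitSum φ m x : ℝ) - (1 + c) * (m * Real.log m)|} ≤
        2 / K + (64 * K / δ ^ 2 * (Real.log m ^ 2)⁻¹ + 1728 / δ ^ 2 * (m : ℝ)⁻¹) := by
    intro K hK
    have hK0 : (0 : ℝ) < K := by exact_mod_cast hK
    filter_upwards [eventually_ge_atTop 1, hlogm.eventually_ge_atTop (1 + Real.log K),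
      (hlogm.const_mul_atTop (show (0 : ℝ) < δ / 4 by positivity)).eventually_ge_atTop
        (2 + (1 + c) * (1 + Real.log K))] with m hm h1 h2
    have hm0 : (0 : ℝ) < m := by exact_mod_cast hm
    have hlog0 : 0 < Real.log m := by
      linarith [Real.log_nonneg (show (1 : ℝ) ≤ K by exact_mod_cast hK)]
    -- Only the first of the three exceptional sets does not shrink as `m` grows with `K` fixed,
    -- and it has measure at most `2 / K`.
    set M : ℝ → ℝ := fun x => ∑ i ∈ Finset.range m,
      (truncDigit (K * m) (φ i) x - truncMean (K * m) (state (φ i) x)) with hM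
    set A : ℝ → ℝ := fun x => ∑ i ∈ Finset.range m, (state (φ i) x - c) with hA
    have hsub : {x | δ * (m * Real.log m) ≤
        |(digitSum φ m x : ℝ) - (1 + c) * (m * Real.log m)|} ⊆
        {x | ∃ i < m, K * m < digit (φ i) x} ∪
          ({x | δ / 4 * (m * Real.log m) ≤ |M x|} ∪ {x | δ / 8 * m ≤ |A x|}) := by
      intro x hx
      by_contra hcon
      simp only [mem_union, mem_ofPred_eq, not_or, not_exists, not_and, not_le, not_lt] at hcon hx
      exact absurd hx (not_le.2
        (abs_digitSum_sub_lt hK hm hc0 h1 h2 hcon.1 hcon.2.1 hcon.2.2))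
    have b1 : unif.real {x | ∃ i < m, K * m < digit (φ i) x} ≤ 2 / K := by
      refine (measureReal_exists_lt_digit_le φ (K * m) m).trans ?_
      push_cast
      rw [mul_div_assoc', div_le_div_iff₀ (by positivity) hK0]
      nlinarith
    have b2 : unif.real {x | δ / 4 * (m * Real.log m) ≤ |M x|} ≤
        64 * K / δ ^ 2 * (Real.log m ^ 2)⁻¹ := by
      refine (measureReal_le_abs_le (C := m * (K * m : ℕ)) (Finset.measurable_fun_sum _ fun i _ =>
        (measurable_truncDigit _ _).sub (measurable_truncMean_state _ _)) (fun x => ?_)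
        (by positivity) (integral_sum_truncDigit_sub_sq_le hφ (K * m) m)).trans_eq ?_
      · refine (Finset.abs_sum_le_sum_abs _ _).trans ?_
        refine (Finset.sum_le_card_nsmul _ _ ((K * m : ℕ) : ℝ) fun i _ => ?_).trans (by simp)
        have h1 := truncDigit_nonneg (K * m) (φ i) x
        have h2 := truncDigit_le (K * m) (φ i) x
        have h3 := truncMean_nonneg (K * m) (state_mem (φ i) x).1
        have h4 := truncMean_le (K * m) (state_mem (φ i) x).1
        rw [Pi.sub_apply, abs_le]; constructor <;> linarith
      · push_cast
        field_simp
        norm_num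
    have b3 : unif.real {x | δ / 8 * m ≤ |A x|} ≤ 1728 / δ ^ 2 * (m : ℝ)⁻¹ := by
      refine (measureReal_le_abs_le (C := m * 3) (Finset.measurable_fun_sum _ fun i _ =>
        (measurable_state _).sub_const _) (fun x => ?_)
        (by positivity) (integral_sum_state_sub_sq_le hc hφ m)).trans_eq ?_
      · refine (Finset.abs_sum_le_sum_abs _ _).trans ?_
        refine (Finset.sum_le_card_nsmul _ _ (3 : ℝ) fun i _ => ?_).trans (by simp)
        simpa using hc 0 _ (state_mem (φ i) x)
      · field_simp
        norm_num
    calc _ ≤ _ := measureReal_mono hsub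
      _ ≤ _ := measureReal_union_le _ _
      _ ≤ _ := add_le_add b1 ((measureReal_union_le _ _).trans (add_le_add b2 b3))
  refine tendsto_order.2 ⟨fun a ha => .of_forall fun m => ha.trans_le measureReal_nonneg,
    fun a ha => ?_⟩
  obtain ⟨K, hK⟩ := exists_nat_gt (4 / a)
  have hK0 : (0 : ℝ) < K := (by positivity : (0 : ℝ) < 4 / a).trans hK
  have hrest : Tendsto (fun m : ℕ => 64 * K / δ ^ 2 * (Real.log m ^ 2)⁻¹ +
      1728 / δ ^ 2 * (m : ℝ)⁻¹) atTop (𝓝 (64 * K / δ ^ 2 * 0 + 1728 / δ ^ 2 * 0)) :=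
    (((tendsto_pow_atTop two_ne_zero).comp hlogm).inv_tendsto_atTop.const_mul _).add
      (tendsto_natCast_atTop_atTop.inv_tendsto_atTop.const_mul _)
  have hlt : 2 / (K : ℝ) < a / 2 := by
    rw [div_lt_div_iff₀ hK0 two_pos]
    rw [div_lt_iff₀ ha] at hK
    linarith
  filter_upwards [hbound K (by exact_mod_cast hK0),
    hrest.eventually_lt_const (show _ < a / 2 by simp; positivity)] with m h1 h2
  linarith

/-- A crude upper bound for the sum of the first `n` digits. -/
lemma measureReal_le_digitSum_le {K n : ℕ} (hK : 1 ≤ K) (hn : 1 ≤ n) :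
    unif.real {x | K * n * (1 + Real.log (K * n)) < digitSum id n x} ≤ 4 / K := by
  have hK0 : (0 : ℝ) < K := by exact_mod_cast hK
  have hn0 : (0 : ℝ) < n := by exact_mod_cast hn
  set L := 1 + Real.log (K * n) with hL
  have hKn : (1 : ℝ) ≤ K * n := by exact_mod_cast Nat.one_le_iff_ne_zero.2 (by positivity)
  have hL0 : 0 < L := by have := Real.log_nonneg hKn; linarith
  have hsub : {x | K * n * L < digitSum id n x} ⊆ {x | ∃ i < n, K * n < digit (id i) x} ∪
      {x | K * n * L ≤ ∑ i ∈ Finset.range n, truncDigit (K * n) i x} := by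
    intro x hx
    by_contra hcon
    simp only [mem_union, mem_ofPred_eq, not_or, not_exists, not_and, not_le, not_lt] at hcon hx
    have := digitSum_eq_sum_truncDigit hcon.1
    simp only [id] at this
    rw [this] at hx
    linarith [hcon.2]
  have hi : ∀ i, Integrable (truncDigit (K * n) i) unif := fun i =>
    integrable_unif_of_bound (C := ((K * n : ℕ) : ℝ)) (measurable_truncDigit _ _) fun x => by
      rw [abs_of_nonneg (truncDigit_nonneg _ _ _)]; exact truncDigit_le _ _ _
  have b1 : unif.real {x | ∃ i < n, K * n < digit (id i) x} ≤ 2 / K := by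
    refine (measureReal_exists_lt_digit_le id (K * n) n).trans ?_
    push_cast
    rw [mul_div_assoc', div_le_div_iff₀ (by positivity) hK0]
    nlinarith
  have b2 : unif.real {x | K * n * L ≤ ∑ i ∈ Finset.range n, truncDigit (K * n) i x} ≤ 2 / K := by
    have h := mul_meas_ge_le_integral_of_nonneg (μ := unif)
      (f := fun x => ∑ i ∈ Finset.range n, truncDigit (K * n) i x)
      (.of_forall fun x => Finset.sum_nonneg fun i _ => truncDigit_nonneg _ _ _)
      (integrable_finsetSum _ fun i _ => hi i) (K * n * L)
    rw [integral_finsetSum _ fun i _ => hi i] at h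
    have h2 : ∑ i ∈ Finset.range n, ∫ x, truncDigit (K * n) i x ∂unif ≤ n * (2 * L) := by
      refine (Finset.sum_le_card_nsmul _ _ (2 * L) fun i _ => ?_).trans (by simp)
      refine (integral_truncDigit_le _ _).trans ?_
      have := sum_inv_le_one_add_log (K * n)
      push_cast at this
      linarith
    have h3 := h.trans h2
    rw [le_div_iff₀ hK0]
    have : (n * L) * (unif.real {x | K * n * L ≤ ∑ i ∈ Finset.range n, truncDigit (K * n) i x} * K) ≤
        (n * L) * 2 := by nlinarith
    exact le_of_mul_le_mul_left this (by positivity)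
  calc _ ≤ _ := measureReal_mono hsub
    _ ≤ _ := measureReal_union_le _ _
    _ ≤ 2 / K + 2 / K := add_le_add b1 b2
    _ = 4 / K := by ring

/-! ### Almost surely, digits larger than the sum of their predecessors -/

lemma digitSum_succ (φ : ℕ → ℕ) (n : ℕ) (x : ℝ) :
    digitSum φ (n + 1) x = digitSum φ n x + digit (φ n) x := Finset.sum_range_succ _ _

lemma factorsThrough_digitSum_id (n : ℕ) : (digitSum id n).FactorsThrough (word n) :=
  factorsThrough_sum fun i hi => factorsThrough_word_mono hi (factorsThrough_digit i)

/-- Divergence of `∑ 1 / (n log n)`, by Cauchy condensation. -/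
lemma not_summable_inv_mul_log {K : ℝ} (hK : 1 ≤ K) :
    ¬ Summable fun i : ℕ => (((i : ℝ) + 1) * (1 + Real.log (K * ((i : ℝ) + 1))))⁻¹ := by
  intro h
  have hlogK := Real.log_nonneg hK
  have h1 : Summable fun i : ℕ => ((i : ℝ) * (1 + Real.log (K * i)))⁻¹ := by
    rw [← summable_nat_add_iff 1]
    exact_mod_cast h
  have hnn : ∀ i : ℕ, 0 ≤ ((i : ℝ) * (1 + Real.log (K * i)))⁻¹ := by
    intro i
    rcases i.eq_zero_or_pos with rfl | hi
    · simp
    have : (1 : ℝ) ≤ i := by exact_mod_cast hi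
    have := Real.log_nonneg (show 1 ≤ K * i by nlinarith)
    positivity
  have h2 := (summable_condensed_iff_of_nonneg hnn fun {m n} hm hmn => by
    have hm' : (1 : ℝ) ≤ m := by exact_mod_cast hm
    have hmn' : (m : ℝ) ≤ n := by exact_mod_cast hmn
    have := Real.log_nonneg (show 1 ≤ K * m by nlinarith)
    gcongr).2 h1
  have h3 : Summable fun k : ℕ => ((1 + Real.log K) * ((k : ℝ) + 1))⁻¹ := by
    refine h2.of_nonneg_of_le (fun k => by positivity) fun k => ?_
    have e : Real.log (K * (2 ^ k : ℕ)) = Real.log K + k * Real.log 2 := by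
      rw [Real.log_mul (by positivity) (by positivity)]
      push_cast
      rw [Real.log_pow]
    have hl2 : Real.log 2 ≤ 1 := by linarith [Real.log_two_lt_d9]
    have hl20 : 0 ≤ Real.log 2 := Real.log_nonneg (by norm_num)
    rw [e]
    push_cast
    rw [mul_inv ((2 : ℝ) ^ k), ← mul_assoc, mul_inv_cancel₀ (by positivity), one_mul]
    have hk : (0 : ℝ) ≤ k := k.cast_nonneg
    refine inv_anti₀ (by positivity) ?_
    nlinarith [mul_nonneg hlogK hk, mul_le_mul_of_nonneg_left hl2 hk]
  simp only [mul_inv] at h3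
  rw [summable_mul_left_iff (by positivity)] at h3
  have h4 : Summable fun k : ℕ => (((k + 1 : ℕ) : ℝ))⁻¹ := by exact_mod_cast h3
  rw [summable_nat_add_iff (f := fun k : ℕ => ((k : ℝ))⁻¹) 1] at h4
  exact Real.not_summable_natCast_inv h4

/-- The set of points without a digit, at one of the first `n` indices of the form `2 i + p`,
that is at least `M` times the sum of `r` and of all earlier digits. -/
def noLargeDigit (M r p n : ℕ) : Set ℝ :=
  {x | ∀ i < n, digit (2 * i + p) x < M * (r + digitSum id (2 * i + p) x)}

lemma measurableSet_noLargeDigit (M r p n : ℕ) : MeasurableSet (noLargeDigit M r p n) := by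
  have : noLargeDigit M r p n =
      ⋂ i ∈ Finset.range n, {x | digit (2 * i + p) x < M * (r + digitSum id (2 * i + p) x)} := by
    ext x; simp [noLargeDigit]
  rw [this]
  exact Finset.measurableSet_biInter _ fun i _ => measurableSet_lt (measurable_digit _)
    (((measurable_digitSum id _).const_add r).const_mul M)

/-- Given the past, a digit that large has probability at least `1 / (M (r + S))`, where `S` is the
sum of the earlier digits, which is rarely much larger than `n log n`. -/
lemma measureReal_noLargeDigit_succ_le {M r p n : ℕ} (hM : 1 ≤ M) (hr : 1 ≤ r) {T : ℝ}
    (hT : 0 ≤ T) {η : ℝ} (hη : unif.real {x | T < digitSum id (2 * n + p) x} ≤ η) :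
    unif.real (noLargeDigit M r p (n + 1)) ≤ unif.real (noLargeDigit M r p n) -
      (unif.real (noLargeDigit M r p n) - η) * (M * (r + T))⁻¹ := by
  set N := 2 * n + p with hN
  have hM0 : (1 : ℝ) ≤ M := by exact_mod_cast hM
  have hr0 : (1 : ℝ) ≤ r := by exact_mod_cast hr
  set F := noLargeDigit M r p n with hF
  have hFm : MeasurableSet F := measurableSet_noLargeDigit M r p n
  set J : ℝ → ℕ := fun x => M * (r + digitSum id N x) with hJ
  have hJ1 : ∀ x, 1 ≤ J x := fun x => Nat.one_le_iff_ne_zero.2 (by positivity)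
  have hSf : (digitSum id N).FactorsThrough (word N) := factorsThrough_digitSum_id N
  have hJf : J.FactorsThrough (word N) := fun x y h => by simp only [hJ, hSf h]
  have hFf : (F.indicator (1 : ℝ → ℝ)).FactorsThrough (word N) := by
    have : ∀ x y, word N x = word N y → x ∈ F → y ∈ F := by
      intro x y h hx i hi
      have h1 : digit (2 * i + p) x = digit (2 * i + p) y :=
        factorsThrough_word_mono (by omega) (factorsThrough_digit _) h
      have h2 : digitSum id (2 * i + p) x = digitSum id (2 * i + p) y :=
        factorsThrough_word_mono (by omega) (factorsThrough_digitSum_id _) h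
      rw [← h1, ← h2]
      exact hx i hi
    intro x y h
    by_cases hx : x ∈ F
    · simp [hx, this x y h hx]
    · have hy : y ∉ F := fun hy => hx (this y x h.symm hy)
      simp [hx, hy]
  have key := integral_mul_tail hFf (C := 1) (fun x => by
    by_cases h : x ∈ F <;> simp [h]) hJf hJ1
  have hGm : MeasurableSet {x | J x ≤ digit N x} :=
    measurableSet_le (measurable_of_factorsThrough hJf) (measurable_digit N)
  have hleft : ∫ x, F.indicator 1 x * {x | J x ≤ digit N x}.indicator 1 x ∂unif =
      unif.real (F ∩ {x | J x ≤ digit N x}) := by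
    rw [← integral_indicator_one (hFm.inter hGm)]
    congr 1
    ext x
    rw [inter_indicator_one, Pi.mul_apply]
  have hdiff : unif.real (noLargeDigit M r p (n + 1)) =
      unif.real F - unif.real (F ∩ {x | J x ≤ digit N x}) := by
    rw [← measureReal_sdiff_add_inter (s := F) hGm (h := by finiteness), add_sub_cancel_right]
    congr 1
    ext x
    simp only [hF, noLargeDigit, mem_ofPred_eq, Set.mem_sdiff, not_le, Nat.lt_succ_iff_lt_or_eq,
      or_imp, forall_and, forall_eq, hJ, hN]
  rw [hdiff, ← hleft, key]
  refine sub_le_sub_left ?_ _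
  set G := {x | (digitSum id N x : ℝ) ≤ T} with hG
  have hGm' : MeasurableSet G := measurableSet_le
    ((measurable_of_countable fun a : ℕ => (a : ℝ)).comp (measurable_digitSum id N))
    measurable_const
  have hFG : unif.real F - η ≤ unif.real (F ∩ G) := by
    have h1 : F ⊆ (F ∩ G) ∪ {x | T < digitSum id N x} := fun x hx => by
      by_cases h : (digitSum id N x : ℝ) ≤ T
      · exact .inl ⟨hx, h⟩
      · exact .inr (not_le.1 h)
    have := (measureReal_mono (μ := unif) h1).trans (measureReal_union_le _ _)
    linarith
  have hpos : 0 < (M * (r + T))⁻¹ := by positivity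
  calc (unif.real F - η) * (M * (r + T))⁻¹ ≤ unif.real (F ∩ G) * (M * (r + T))⁻¹ := by gcongr
    _ = ∫ x, (F ∩ G).indicator 1 x * (M * (r + T))⁻¹ ∂unif := by
        rw [integral_mul_const, integral_indicator_one (hFm.inter hGm')]
    _ ≤ _ := by
        refine integral_mono (((integrable_const (1 : ℝ)).indicator (hFm.inter hGm')).mul_const _)
          (integrable_unif_of_bound (C := 1) ?_ fun x => ?_) fun x => ?_
        · exact (measurable_of_factorsThrough hFf).mul (measurable_of_factorsThrough (n := N)
            fun x y h => by simp only [factorsThrough_state N h, hJf h])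
        · obtain ⟨h0, h1⟩ := state_mem N x
          have hJx : (1 : ℝ) ≤ J x := by exact_mod_cast hJ1 x
          rw [abs_mul]
          refine mul_le_one₀ (by by_cases h : x ∈ F <;> simp [h]) (abs_nonneg _) ?_
          rw [abs_of_nonneg (by positivity), div_le_one (by positivity)]
          linarith
        · obtain ⟨h0, h1⟩ := state_mem N x
          have hJx : (1 : ℝ) ≤ J x := by exact_mod_cast hJ1 x
          dsimp only
          by_cases hx : x ∈ F
          · by_cases hxG : x ∈ G
            · simp only [mem_inter_iff, hx, hxG, and_self, indicator_of_mem, Pi.one_apply, one_mul]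
              have hJT : (J x : ℝ) ≤ M * (r + T) := by
                simp only [hJ]
                push_cast
                have : (digitSum id N x : ℝ) ≤ T := hxG
                gcongr
              calc _ ≤ (J x : ℝ)⁻¹ := inv_anti₀ (by positivity) hJT
                _ ≤ _ := by
                  rw [inv_eq_one_div, div_le_div_iff₀ (by positivity) (by positivity)]
                  nlinarith
            · simp only [mem_inter_iff, hx, hxG, and_false, not_false_iff, indicator_of_notMem,
                indicator_of_mem, Pi.one_apply, one_mul, zero_mul]
              positivity
          · simp [hx]

/-- Almost every point has a digit, at an index of prescribed parity, that is at least `M` times the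
sum of `r` and of all earlier digits. -/
lemma ae_exists_large_digit {M r p : ℕ} (hM : 1 ≤ M) (hr : 1 ≤ r) :
    ∀ᵐ x ∂unif, ∃ i, M * (r + digitSum id (2 * i + p) x) ≤ digit (2 * i + p) x := by
  set q : ℕ → ℝ := fun n => unif.real (noLargeDigit M r p n) with hq
  set h : ℝ := unif.real {x | ∀ i, digit (2 * i + p) x < M * (r + digitSum id (2 * i + p) x)} with hh
  have hle : ∀ n, h ≤ q n := fun n => measureReal_mono fun x hx i _ => hx i
  suffices h0 : h = 0 by
    rw [hh, measureReal_eq_zero_iff] at h0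
    rw [ae_iff]
    simpa using h0
  by_contra hne
  have hpos : 0 < h := lt_of_le_of_ne measureReal_nonneg (Ne.symm hne)
  -- `K` is so large that the sum of the first `n` digits exceeds `K n (1 + log (K n))` with
  -- probability at most `h / 2`. Each step then lowers `q` by a multiple of `1 / (n log n)`.
  obtain ⟨K, hK⟩ := exists_nat_gt (8 / h)
  have hK0 : (0 : ℝ) < K := (by positivity : (0 : ℝ) < 8 / h).trans hK
  have hK1 : 1 ≤ K := by exact_mod_cast hK0
  have hK1' : (1 : ℝ) ≤ K := by exact_mod_cast hK1
  have hKh : 4 / (K : ℝ) ≤ h / 2 := by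
    rw [div_le_div_iff₀ hK0 two_pos]
    rw [div_lt_iff₀ hpos] at hK
    linarith
  set K' : ℝ := K * (2 + p) with hK'
  have hK'1 : 1 ≤ K' := by rw [hK']; nlinarith [p.cast_nonneg (α := ℝ)]
  set g : ℕ → ℝ := fun n => (((n : ℝ) + 1) * (1 + Real.log (K' * ((n : ℝ) + 1))))⁻¹ with hg
  have hlog : ∀ n : ℕ, 0 ≤ Real.log (K' * ((n : ℝ) + 1)) := fun n =>
    Real.log_nonneg (by nlinarith [n.cast_nonneg (α := ℝ)])
  have hg0 : ∀ n, 0 ≤ g n := fun n => by have := hlog n; positivity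
  have hM0 : (1 : ℝ) ≤ M := by exact_mod_cast hM
  have hr0 : (1 : ℝ) ≤ r := by exact_mod_cast hr
  have hstep : ∀ n, h / 2 * (M * (r + K'))⁻¹ * g n ≤ q n - q (n + 1) := by
    intro n
    have hn : (0 : ℝ) ≤ n := n.cast_nonneg
    have hlogn := hlog n
    set T : ℝ := K' * ((n : ℝ) + 1) * (1 + Real.log (K' * ((n : ℝ) + 1))) with hT
    have hT0 : 0 ≤ T := by positivity
    have hη : unif.real {x | T < digitSum id (2 * n + p) x} ≤ h / 2 := by
      rcases Nat.eq_zero_or_pos (2 * n + p) with h0 | h0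
      · have : {x | T < digitSum id (2 * n + p) x} = ∅ := by
          ext x; simp [h0, digitSum, hT0]
        rw [this]; simp; positivity
      · refine ((measureReal_mono fun x hx => ?_).trans
          (measureReal_le_digitSum_le hK1 h0)).trans hKh
        simp only [mem_ofPred_eq] at hx ⊢
        refine lt_of_le_of_lt ?_ hx
        have h1 : (K : ℝ) * (2 * n + p : ℕ) ≤ K' * ((n : ℝ) + 1) := by
          rw [hK', mul_assoc]
          push_cast
          have : 0 ≤ (p : ℝ) * n := by positivity
          gcongr
          linarith
        have h2 : (0 : ℝ) < K * (2 * n + p : ℕ) := by positivity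
        have h3 := Real.log_le_log h2 h1
        have h4 : 0 ≤ Real.log ((K : ℝ) * (2 * n + p : ℕ)) := by
          refine Real.log_nonneg ?_
          have : (1 : ℝ) ≤ (2 * n + p : ℕ) := by exact_mod_cast h0
          nlinarith
        exact mul_le_mul h1 (by linarith) (by linarith) (by positivity)
    have h1 := measureReal_noLargeDigit_succ_le (n := n) hM hr hT0 hη
    have h2 : (M * (r + K'))⁻¹ * g n ≤ (M * (r + T))⁻¹ := by
      rw [hg, ← mul_inv]
      refine inv_anti₀ (by positivity) ?_
      have : (1 : ℝ) ≤ ((n : ℝ) + 1) * (1 + Real.log (K' * ((n : ℝ) + 1))) := by nlinarith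
      rw [mul_assoc]
      gcongr
      rw [hT]
      nlinarith
    have h3 : h / 2 * ((M * (r + K'))⁻¹ * g n) ≤ (q n - h / 2) * (M * (r + T))⁻¹ :=
      mul_le_mul (by linarith [hle n]) h2 (mul_nonneg (by positivity) (hg0 n))
        (by linarith [hle n])
    rw [← mul_assoc] at h3
    linarith
  have hsum : Summable fun n => h / 2 * (M * (r + K'))⁻¹ * g n := by
    refine summable_of_sum_range_le (c := 1) (fun n => mul_nonneg (by positivity) (hg0 n))
      fun n => (Finset.sum_le_sum fun i _ => hstep i).trans ?_
    rw [Finset.sum_range_sub']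
    have h1 : q 0 ≤ 1 := measureReal_le_one
    have h2 : 0 ≤ q n := measureReal_nonneg
    linarith
  exact not_summable_inv_mul_log hK'1 ((summable_mul_left_iff (by positivity)).1 hsum)

/-! ### The negative expansion in terms of regular digits -/

/-- The sum of the first `n` digits `-⌊-1 / T^k y⌋`, `k < n`, along the orbit of `y` under
`T = cfMap (-1)`. The negative digits of `x` are those of `y = 1 - x`. -/
def backwardSum (n : ℕ) (y : ℝ) : ℤ :=
  ∑ k ∈ Finset.range n, -⌊(-1 : ℝ) / (cfMap (-1))^[k] y⌋

lemma backwardSum_zero (y : ℝ) : backwardSum 0 y = 0 := rfl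

lemma backwardSum_succ' (n : ℕ) (y : ℝ) :
    backwardSum (n + 1) y = -⌊(-1 : ℝ) / y⌋ + backwardSum n (cfMap (-1) y) := by
  simp only [backwardSum]
  rw [Finset.sum_range_succ', add_comm]
  rfl

lemma negDigitMean_eq (n : ℕ) (x : ℝ) :
    negDigitMean n x = backwardSum n (1 - x) / n := by
  have h : ∀ m : ℕ, ∑ k ∈ Finset.Icc 1 m, (negDigit x k : ℝ) = backwardSum m (1 - x) := by
    intro m
    induction m with
    | zero => simp [backwardSum]
    | succ m ih =>
      rw [Finset.sum_Icc_succ_top (by omega), ih, backwardSum, backwardSum,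
        Finset.sum_range_succ, negDigit, Nat.add_sub_cancel]
      push_cast
      rfl
  rw [negDigitMean, h, one_div, inv_mul_eq_div]

lemma floor_and_cfMap {y f : ℝ} {d : ℤ} (hy : y ≠ 0) (hf : f ∈ Ico (0 : ℝ) 1)
    (h : -1 / y = -d + f) : -⌊(-1 : ℝ) / y⌋ = d ∧ cfMap (-1) y = f := by
  have hfl : ⌊(-1 : ℝ) / y⌋ = -d := by
    rw [h, Int.floor_eq_iff]; push_cast; constructor <;> linarith [hf.1, hf.2]
  refine ⟨by rw [hfl, neg_neg], ?_⟩
  rw [cfMap, if_neg hy]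
  push_cast
  rw [hfl, h]
  push_cast
  ring

/-- If the leading regular digit `k + 2` of `x` is at least `2`, then the first negative digit of `x`
is `2`, and removing it lowers the regular digit by one. -/
lemma backward_step_two (k : ℕ) {t : ℝ} (ht : t ∈ Ioo (0 : ℝ) 1) :
    -⌊(-1 : ℝ) / (1 - ((k : ℝ) + 1 + 1 + t)⁻¹)⌋ = 2 ∧
      cfMap (-1) (1 - ((k : ℝ) + 1 + 1 + t)⁻¹) = 1 - ((k : ℝ) + 1 + t)⁻¹ := by
  have ht0 := ht.1
  have h1 : 0 < (k : ℝ) + 1 + t := by positivity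
  have e : 1 - ((k : ℝ) + 1 + 1 + t)⁻¹ = ((k : ℝ) + 1 + t) / ((k : ℝ) + 1 + 1 + t) := by
    field_simp; ring
  refine floor_and_cfMap (by rw [e]; positivity) ⟨?_, ?_⟩ ?_
  · rw [sub_nonneg]; exact inv_le_one_of_one_le₀ (by linarith [k.cast_nonneg (α := ℝ)])
  · have := inv_pos.2 h1; linarith
  · rw [e]; push_cast; field_simp; ring

/-- If the regular digits of `x` start with `1, k + 1`, then the first negative digit of `x` is
`k + 3`, and removing it removes both regular digits. -/
lemma backward_step_last (k : ℕ) {t : ℝ} (ht : t ∈ Ioo (0 : ℝ) 1) :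
    -⌊(-1 : ℝ) / (1 - (1 + ((k : ℝ) + 1 + t)⁻¹)⁻¹)⌋ = k + 1 + 2 ∧
      cfMap (-1) (1 - (1 + ((k : ℝ) + 1 + t)⁻¹)⁻¹) = 1 - t := by
  have ht0 := ht.1
  have e : 1 - (1 + ((k : ℝ) + 1 + t)⁻¹)⁻¹ = ((k : ℝ) + 1 + 1 + t)⁻¹ := by
    field_simp; ring
  refine floor_and_cfMap (by rw [e]; positivity) ⟨by linarith [ht.2], by linarith⟩ ?_
  rw [e]; push_cast; field_simp; ring

lemma backwardSum_of_le {k j : ℕ} (hj : j ≤ k) {t : ℝ} (ht : t ∈ Ioo (0 : ℝ) 1) :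
    backwardSum j (1 - ((k : ℝ) + 1 + t)⁻¹) = 2 * j := by
  induction j generalizing k with
  | zero => simp [backwardSum]
  | succ j ih =>
    obtain ⟨k, rfl⟩ : ∃ k', k = k' + 1 := ⟨k - 1, by omega⟩
    push_cast
    obtain ⟨h1, h2⟩ := backward_step_two k ht
    rw [backwardSum_succ', h1, h2, ih (by omega)]
    ring

lemma backwardSum_add (k b n : ℕ) {t : ℝ} (ht : t ∈ Ioo (0 : ℝ) 1) :
    backwardSum (k + 1 + n) (1 - ((k : ℝ) + 1 + ((b : ℝ) + 1 + t)⁻¹)⁻¹) =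
      2 * (k + 1) + (b + 1) + backwardSum n (1 - t) := by
  induction k with
  | zero =>
    obtain ⟨h1, h2⟩ := backward_step_last b ht
    have : 0 + 1 + n = n + 1 := by ring
    rw [this, backwardSum_succ']
    simp only [Nat.cast_zero, zero_add]
    rw [h1, h2]
    ring
  | succ k ih =>
    have hz : ((b : ℝ) + 1 + t)⁻¹ ∈ Ioo (0 : ℝ) 1 := by
      have := ht.1
      exact ⟨by positivity, inv_lt_one_of_one_lt₀ (by linarith [b.cast_nonneg (α := ℝ)])⟩
    obtain ⟨h1, h2⟩ := backward_step_two k hz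
    have : k + 1 + 1 + n = k + 1 + n + 1 := by ring
    push_cast
    rw [this, backwardSum_succ', h1, h2, ih]
    ring

/-! ### Irrational points -/

/-- The irrational points of the unit interval. -/
def irrUnit : Set ℝ := {x | x ∈ Ioo (0 : ℝ) 1 ∧ Irrational x}

lemma ae_mem_irrUnit : ∀ᵐ x ∂unif, x ∈ irrUnit := by
  have h : ∀ᵐ x ∂unif, Irrational x :=
    ae_restrict_of_ae ((countable_range ((↑) : ℚ → ℝ)).ae_notMem volume)
  filter_upwards [h, ae_restrict_mem measurableSet_Ioo] with x h1 h2 using ⟨h2, h1⟩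

lemma fract_mem_irrUnit {z : ℝ} (hz : Irrational z) : Int.fract z ∈ irrUnit := by
  have h : Irrational (Int.fract z) := hz.sub_intCast _
  exact ⟨⟨lt_of_le_of_ne (Int.fract_nonneg z) h.ne_zero.symm, Int.fract_lt_one z⟩, h⟩

lemma gauss_mem_irrUnit {x : ℝ} (hx : x ∈ irrUnit) : gauss x ∈ irrUnit :=
  fract_mem_irrUnit hx.2.inv

lemma gauss_iterate_mem_irrUnit {x : ℝ} (hx : x ∈ irrUnit) (n : ℕ) : gauss^[n] x ∈ irrUnit := by
  induction n with
  | zero => exact hx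
  | succ n ih => rw [Function.iterate_succ_apply']; exact gauss_mem_irrUnit ih

lemma one_sub_mem_irrUnit {x : ℝ} (hx : x ∈ irrUnit) : 1 - x ∈ irrUnit :=
  ⟨⟨by linarith [hx.1.2], by linarith [hx.1.1]⟩, by simpa using hx.2.natCast_sub 1⟩

lemma cfMap_mem_irrUnit {y : ℝ} (hy : y ∈ irrUnit) : cfMap (-1) y ∈ irrUnit := by
  rw [cfMap, if_neg hy.1.1.ne']
  refine fract_mem_irrUnit ?_
  have := hy.2.inv.neg
  push_cast
  rwa [neg_div, one_div]

lemma two_le_neg_floor {y : ℝ} (hy : y ∈ irrUnit) : 2 ≤ -⌊(-1 : ℝ) / y⌋ := by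
  have h : ⌊(-1 : ℝ) / y⌋ < -1 := by
    rw [Int.floor_lt]
    push_cast
    rw [div_lt_iff₀ hy.1.1]
    linarith [hy.1.2]
  omega

lemma monotone_backwardSum_sub {y : ℝ} (hy : y ∈ irrUnit) :
    Monotone fun n : ℕ => backwardSum n y - 2 * n := by
  refine monotone_nat_of_le_succ fun n => ?_
  have h : (cfMap (-1))^[n] y ∈ irrUnit := by
    induction n with
    | zero => exact hy
    | succ n ih => rw [Function.iterate_succ_apply']; exact cfMap_mem_irrUnit ih
  have := two_le_neg_floor h
  simp only [backwardSum, Finset.sum_range_succ]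
  push_cast
  linarith

lemma eq_inv_leadDigit_add_gauss {x : ℝ} (hx : x ∈ Ioo (0 : ℝ) 1) :
    ∃ k : ℕ, leadDigit x = k + 1 ∧ x = ((k : ℝ) + 1 + gauss x)⁻¹ := by
  have h1 : 1 ≤ x⁻¹ := (one_le_inv₀ hx.1).2 hx.2.le
  have h2 : 1 ≤ ⌊x⁻¹⌋₊ := Nat.one_le_floor_iff _ |>.2 h1
  refine ⟨⌊x⁻¹⌋₊ - 1, by rw [leadDigit]; omega, ?_⟩
  rw [Nat.cast_sub h2, gauss, Int.fract, ← natCast_floor_eq_intCast_floor (by linarith)]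
  push_cast
  rw [sub_add_cancel, add_sub_cancel, inv_inv]

/-- The regular digits `a₁, a₂` produce the block `2, …, 2, a₂ + 2` of `a₁` negative digits. -/
lemma backwardSum_leadDigit_add {x : ℝ} (hx : x ∈ irrUnit) (n : ℕ) :
    backwardSum (leadDigit x + n) (1 - x) =
      2 * leadDigit x + leadDigit (gauss x) + backwardSum n (1 - gauss (gauss x)) := by
  obtain ⟨k, hk, hxk⟩ := eq_inv_leadDigit_add_gauss hx.1
  obtain ⟨b, hb, hxb⟩ := eq_inv_leadDigit_add_gauss (gauss_mem_irrUnit hx).1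
  have := backwardSum_add k b n (gauss_mem_irrUnit (gauss_mem_irrUnit hx)).1
  rw [← hxb, ← hxk] at this
  rw [hk, hb, this]
  push_cast
  ring

lemma backwardSum_digitSum_add {x : ℝ} (hx : x ∈ irrUnit) (m n : ℕ) :
    backwardSum (digitSum (2 * ·) m x + n) (1 - x) =
      2 * digitSum (2 * ·) m x + digitSum (2 * · + 1) m x +
        backwardSum n (1 - gauss^[2 * m] x) := by
  induction m generalizing n with
  | zero => simp [digitSum]
  | succ m ih =>
    rw [digitSum_succ, digitSum_succ, add_assoc, ih, digit,
      backwardSum_leadDigit_add (gauss_iterate_mem_irrUnit hx _), digit,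
      Function.iterate_succ_apply' gauss (2 * m), show 2 * (m + 1) = 2 * m + 1 + 1 by ring,
      Function.iterate_succ_apply' gauss (2 * m + 1), Function.iterate_succ_apply' gauss (2 * m)]
    push_cast
    ring

lemma backwardSum_digitSum {x : ℝ} (hx : x ∈ irrUnit) (m : ℕ) :
    backwardSum (digitSum (2 * ·) m x) (1 - x) - 2 * digitSum (2 * ·) m x =
      digitSum (2 * · + 1) m x := by
  have := backwardSum_digitSum_add hx m 0
  rw [add_zero, backwardSum_zero] at this
  rw [this]; ring

/-- The last digit of a block being removed, the block consists of digits `2` only. -/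
lemma backwardSum_digitSum_succ_sub_one {x : ℝ} (hx : x ∈ irrUnit) (m : ℕ) :
    backwardSum (digitSum (2 * ·) (m + 1) x - 1) (1 - x) -
      2 * (digitSum (2 * ·) (m + 1) x - 1 : ℕ) = digitSum (2 * · + 1) m x := by
  have hd := one_le_digit (2 * m) x
  obtain ⟨k, hk, hxk⟩ := eq_inv_leadDigit_add_gauss (gauss_iterate_mem_irrUnit hx (2 * m)).1
  have hk' : digit (2 * m) x = k + 1 := hk
  have h1 := backwardSum_of_le le_rfl (gauss_mem_irrUnit (gauss_iterate_mem_irrUnit hx (2 * m))).1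
    (k := k)
  rw [← hxk] at h1
  rw [digitSum_succ, hk', ← add_assoc, Nat.add_sub_cancel, backwardSum_digitSum_add hx, h1]
  push_cast
  ring

/-! ### Bounds for the means of the negative digits -/

lemma negDigitMean_eq_two_add {n : ℕ} (hn : 1 ≤ n) (x : ℝ) :
    negDigitMean n x = 2 + ((backwardSum n (1 - x) - 2 * n : ℤ) : ℝ) / n := by
  have : (n : ℝ) ≠ 0 := by positivity
  rw [negDigitMean_eq]
  push_cast
  field_simp
  ring

lemma le_negDigitMean {x : ℝ} (hx : x ∈ irrUnit) {m n : ℕ} (hn : 1 ≤ n)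
    (hmn : digitSum (2 * ·) m x ≤ n) :
    2 + (digitSum (2 * · + 1) m x : ℝ) / n ≤ negDigitMean n x := by
  have h := monotone_backwardSum_sub (one_sub_mem_irrUnit hx) hmn
  dsimp only at h
  rw [backwardSum_digitSum hx] at h
  rw [negDigitMean_eq_two_add hn]
  gcongr
  exact_mod_cast h

lemma negDigitMean_le {x : ℝ} (hx : x ∈ irrUnit) {m n : ℕ} (hn : 1 ≤ n)
    (hmn : n ≤ digitSum (2 * ·) m x) :
    negDigitMean n x ≤ 2 + (digitSum (2 * · + 1) m x : ℝ) / n := by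
  have h := monotone_backwardSum_sub (one_sub_mem_irrUnit hx) hmn
  dsimp only at h
  rw [backwardSum_digitSum hx] at h
  rw [negDigitMean_eq_two_add hn]
  gcongr
  exact_mod_cast h

lemma two_le_negDigitMean {x : ℝ} (hx : x ∈ irrUnit) {n : ℕ} (hn : 1 ≤ n) :
    2 ≤ negDigitMean n x := by
  have := le_negDigitMean hx hn (m := 0) (by simp [digitSum])
  simpa [digitSum] using this

/-! ### Convergence in measure -/

/-- The function `m ↦ κ m log m` has nearly constant ratio of consecutive values, so it meets every
window `[a n, b n]` with `a < b` once `n` is large. -/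
lemma exists_tendsto_mul_log_mem {κ a b : ℝ} (hκ : 0 < κ) (ha : 0 < a) (hab : a < b) :
    ∃ m : ℕ → ℕ, Tendsto m atTop atTop ∧
      ∀ᶠ n : ℕ in atTop, a * n ≤ κ * (m n * Real.log (m n)) ∧
        κ * (m n * Real.log (m n)) ≤ b * n := by
  set f : ℕ → ℝ := fun m => κ * (m * Real.log m) with hf
  have hlog : Tendsto (fun m : ℕ => Real.log m) atTop atTop :=
    Real.tendsto_log_atTop.comp tendsto_natCast_atTop_atTop
  have hft : Tendsto f atTop atTop :=
    (tendsto_natCast_atTop_atTop.atTop_mul_atTop₀ hlog).const_mul_atTop hκ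
  have hex : ∀ n : ℕ, ∃ m, a * n ≤ f m := fun n => (hft.eventually_ge_atTop (a * n)).exists
  classical
  refine ⟨fun n => Nat.find (hex n), ?_, ?_⟩
  · refine tendsto_atTop.2 fun M => ?_
    obtain ⟨U, hU⟩ := ((Finset.range M).image f).bddAbove
    filter_upwards [(tendsto_natCast_atTop_atTop.const_mul_atTop ha).eventually_gt_atTop U] with n hn
    by_contra! hlt
    have h1 := Nat.find_spec (hex n)
    have h2 : f (Nat.find (hex n)) ≤ U :=
      hU (Finset.mem_coe.2 (Finset.mem_image_of_mem f (Finset.mem_range.2 hlt)))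
    linarith
  · have hratio : ∀ᶠ m : ℕ in atTop, f (m + 1) ≤ b / a * f m := by
      have hba : 0 < b / a - 1 := by rw [sub_pos, one_lt_div ha]; exact hab
      filter_upwards [hlog.eventually_ge_atTop 1,
        (tendsto_natCast_atTop_atTop (R := ℝ)).eventually_ge_atTop (3 / (b / a - 1)),
        eventually_ge_atTop 1] with m h1 h2 h3
      have hm0 : (1 : ℝ) ≤ m := by exact_mod_cast h3
      have hl : Real.log ((m : ℝ) + 1) ≤ Real.log m + (m : ℝ)⁻¹ := by
        have e : (m : ℝ) + 1 = m * (1 + (m : ℝ)⁻¹) := by field_simp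
        rw [e, Real.log_mul (by positivity) (by positivity)]
        have := Real.log_le_sub_one_of_pos (show (0 : ℝ) < 1 + (m : ℝ)⁻¹ by positivity)
        linarith
      have hinv : (m : ℝ)⁻¹ ≤ 1 := inv_le_one_of_one_le₀ hm0
      rw [div_le_iff₀ hba] at h2
      have h4 : 3 * Real.log m ≤ m * (b / a - 1) * Real.log m := by gcongr
      have h5 : ((m : ℝ) + 1) * (m : ℝ)⁻¹ ≤ 2 := by
        rw [add_mul, mul_inv_cancel₀ (by positivity)]; linarith
      have h6 : ((m : ℝ) + 1) * Real.log ((m : ℝ) + 1) ≤ b / a * (m * Real.log m) := by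
        have := mul_le_mul_of_nonneg_left hl (show (0 : ℝ) ≤ (m : ℝ) + 1 by positivity)
        nlinarith
      simp only [hf]
      push_cast
      nlinarith
    obtain ⟨M, hM⟩ := eventually_atTop.1 hratio
    obtain ⟨U, hU⟩ := ((Finset.range (M + 1)).image f).bddAbove
    filter_upwards [(tendsto_natCast_atTop_atTop.const_mul_atTop ha).eventually_gt_atTop U] with n hn
    have h1 := Nat.find_spec (hex n)
    refine ⟨h1, ?_⟩
    have hgt : M < Nat.find (hex n) := by
      by_contra! hlt
      have h2 : f (Nat.find (hex n)) ≤ U :=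
        hU (Finset.mem_coe.2 (Finset.mem_image_of_mem f (Finset.mem_range.2 (by omega))))
      linarith
    obtain ⟨k, hk⟩ : ∃ k, Nat.find (hex n) = k + 1 := ⟨Nat.find (hex n) - 1, by omega⟩
    have h3 : f k < a * n := not_le.1 (Nat.find_min (hex n) (by omega))
    have h4 := hM k (by omega)
    change f (Nat.find (hex n)) ≤ b * n
    rw [hk]
    calc _ ≤ _ := h4
      _ ≤ b / a * (a * n) := by
        have : 0 < b / a := by have := ha.trans hab; positivity
        gcongr
      _ = b * n := by field_simp

lemma tendsto_measure_negDigitMean {ε : ℝ} (hε : 0 < ε) :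
    Tendsto (fun n : ℕ => unif {x | |negDigitMean n x - 3| > ε}) atTop (𝓝 0) := by
  obtain ⟨κ, hκ, hlaw⟩ := exists_tendsto_digitSum
  have hevenφ : StrictMono fun i : ℕ => 2 * i := fun i j h => by dsimp only; omega
  have hoddφ : StrictMono fun i : ℕ => 2 * i + 1 := fun i j h => by dsimp only; omega
  set δ : ℝ := min (ε / 3) (1 / 4) with hδdef
  have hδ0 : 0 < δ := by positivity
  have hδ1 : δ ≤ 1 / 4 := min_le_right _ _
  have hδε : 3 * δ ≤ ε := by linarith [min_le_left (ε / 3) (1 / 4)]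
  set η : ℝ := κ * (δ / 4) with hη
  have hη0 : 0 < η := by positivity
  -- With `N`, `E` the sums of digits at even and odd indices, `N (m₁ n) ≤ n ≤ N (m₂ n)` outside a
  -- set of small measure, so the mean lies between `2 + E (m₁ n) / n` and `2 + E (m₂ n) / n`.
  obtain ⟨m₁, hm₁, hw₁⟩ := exists_tendsto_mul_log_mem hκ (a := 1 - 2 * δ) (b := 1 - δ)
    (by linarith) (by linarith)
  obtain ⟨m₂, hm₂, hw₂⟩ := exists_tendsto_mul_log_mem hκ (a := 1 + δ) (b := 1 + 2 * δ)
    (by linarith) (by linarith)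
  set bad : (ℕ → ℕ) → ℕ → Set ℝ := fun φ m => {x | η * (m * Real.log m) ≤
    |(digitSum φ m x : ℝ) - κ * (m * Real.log m)|} with hbad
  set φ₀ : ℕ → ℕ := (2 * ·) with hφ₀
  set φ₁ : ℕ → ℕ := (2 * · + 1) with hφ₁
  have hlim : Tendsto (fun n => ENNReal.ofReal
      ((unif.real (bad φ₀ (m₁ n)) + unif.real (bad φ₁ (m₁ n))) +
        (unif.real (bad φ₀ (m₂ n)) + unif.real (bad φ₁ (m₂ n))))) atTop (𝓝 0) := by
    have h := (((hlaw φ₀ hevenφ η hη0).comp hm₁).add ((hlaw φ₁ hoddφ η hη0).comp hm₁)).add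
      (((hlaw φ₀ hevenφ η hη0).comp hm₂).add ((hlaw φ₁ hoddφ η hη0).comp hm₂))
    simp only [add_zero] at h
    simpa using ENNReal.tendsto_ofReal h
  refine tendsto_of_tendsto_of_tendsto_of_le_of_le' tendsto_const_nhds hlim
    (.of_forall fun n => zero_le) ?_
  filter_upwards [hw₁, hw₂, eventually_ge_atTop 1] with n h₁ h₂ hn
  have hn0 : (0 : ℝ) < n := by exact_mod_cast hn
  have hgood : ∀ x ∈ irrUnit, |negDigitMean n x - 3| > ε →
      x ∈ (bad φ₀ (m₁ n) ∪ bad φ₁ (m₁ n)) ∪ (bad φ₀ (m₂ n) ∪ bad φ₁ (m₂ n)) := by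
    intro x hx hdev
    by_contra hcon
    simp only [hbad, mem_union, mem_ofPred_eq, not_or, not_le, abs_lt] at hcon
    obtain ⟨⟨⟨-, g1⟩, ⟨g2, -⟩⟩, ⟨⟨g3, -⟩, ⟨-, g4⟩⟩⟩ := hcon
    set f₁ := κ * (m₁ n * Real.log (m₁ n)) with hf₁
    set f₂ := κ * (m₂ n * Real.log (m₂ n)) with hf₂
    have e₁ : η * (m₁ n * Real.log (m₁ n)) = δ / 4 * f₁ := by rw [hη, hf₁]; ring
    have e₂ : η * (m₂ n * Real.log (m₂ n)) = δ / 4 * f₂ := by rw [hη, hf₂]; ring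
    rw [e₁] at g1 g2
    rw [e₂] at g3 g4
    have k1 := mul_le_mul_of_nonneg_left h₁.2 hδ0.le
    have k1' := mul_le_mul_of_nonneg_left h₁.1 hδ0.le
    have k2 := mul_le_mul_of_nonneg_left h₂.2 hδ0.le
    have k2' := mul_le_mul_of_nonneg_left h₂.1 hδ0.le
    have hδn : 0 < δ * n := by positivity
    have hδδn : δ * (δ * n) ≤ 1 / 4 * (δ * n) := by gcongr
    have hδδn0 : 0 ≤ δ * (δ * n) := by positivity
    have hN₁ : digitSum φ₀ (m₁ n) x ≤ n := by
      have : (digitSum φ₀ (m₁ n) x : ℝ) ≤ n := by nlinarith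
      exact_mod_cast this
    have hN₂ : n ≤ digitSum φ₀ (m₂ n) x := by
      have : (n : ℝ) ≤ digitSum φ₀ (m₂ n) x := by nlinarith
      exact_mod_cast this
    have hE₁ : (1 - 3 * δ) * n ≤ digitSum φ₁ (m₁ n) x := by nlinarith
    have hE₂ : (digitSum φ₁ (m₂ n) x : ℝ) ≤ (1 + 3 * δ) * n := by nlinarith
    have u1 := le_negDigitMean hx hn hN₁
    have u2 := negDigitMean_le hx hn hN₂
    have v1 := (le_div_iff₀ hn0).2 hE₁
    have v2 := (div_le_iff₀ hn0).2 hE₂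
    refine absurd hdev (not_lt.2 (abs_le.2 ⟨?_, ?_⟩)) <;> linarith
  calc unif {x | |negDigitMean n x - 3| > ε}
      ≤ unif ((bad φ₀ (m₁ n) ∪ bad φ₁ (m₁ n)) ∪ (bad φ₀ (m₂ n) ∪ bad φ₁ (m₂ n))) :=
        measure_mono_ae (by filter_upwards [ae_mem_irrUnit] with x hx using hgood x hx)
    _ = ENNReal.ofReal (unif.real
          ((bad φ₀ (m₁ n) ∪ bad φ₁ (m₁ n)) ∪ (bad φ₀ (m₂ n) ∪ bad φ₁ (m₂ n)))) :=
        (ofReal_measureReal (by finiteness)).symm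
    _ ≤ _ := ENNReal.ofReal_le_ofReal ((measureReal_union_le _ _).trans
        (add_le_add (measureReal_union_le _ _) (measureReal_union_le _ _)))

/-! ### Oscillation of the means -/

lemma digitSum_even_add_odd (m : ℕ) (x : ℝ) :
    digitSum (2 * ·) m x + digitSum (2 * · + 1) m x = digitSum id (2 * m) x := by
  induction m with
  | zero => rfl
  | succ m ih =>
    rw [digitSum_succ, digitSum_succ, show 2 * (m + 1) = 2 * m + 1 + 1 by ring, digitSum_succ id,
      digitSum_succ id, ← ih]
    simp only [id]
    ring

/-- Just before the end of a block, the mean is `2 + E / n` with `E` at most the sum of the regular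
digits that precede the block and `n` at least its length, up to one. -/
lemma liminf_negDigitMean {x : ℝ} (hx : x ∈ irrUnit)
    (h : ∀ M r : ℕ, 1 ≤ M → 1 ≤ r →
      ∃ i, M * (r + digitSum id (2 * i + 0) x) ≤ digit (2 * i + 0) x) :
    liminf (fun n : ℕ => ((negDigitMean n x : ℝ) : EReal)) atTop = 2 := by
  refine le_antisymm ?_ ?_
  · refine EReal.le_of_forall_lt_iff_le.1 fun z hz => ?_
    have hz' : (2 : ℝ) < z := EReal.coe_lt_coe_iff.1 hz
    refine liminf_le_of_frequently_le' (frequently_atTop.2 fun n₀ => ?_)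
    obtain ⟨M, hM⟩ := exists_nat_gt (1 / (z - 2))
    have hM0 : 0 < M := by
      have : (0 : ℝ) < M := (one_div_pos.2 (by linarith)).trans hM
      exact_mod_cast this
    obtain ⟨i, hi⟩ := h (M + 1) (n₀ + 1) (by omega) (by omega)
    simp only [add_zero] at hi
    set S := digitSum id (2 * i) x
    have hE : digitSum (2 * · + 1) i x ≤ S := by
      have := digitSum_even_add_odd i x
      omega
    -- The time just before the end of the block whose length is the large digit.
    set n := digitSum (2 * ·) (i + 1) x - 1 with hn
    have hn' : M * (n₀ + 1 + S) ≤ n := by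
      have : digitSum (2 * ·) (i + 1) x = digitSum (2 * ·) i x + digit (2 * i) x :=
        digitSum_succ _ _ _
      have hmul : (M + 1) * (n₀ + 1 + S) = M * (n₀ + 1 + S) + (n₀ + 1 + S) := by ring
      omega
    have hn0 : n₀ + 1 + S ≤ n := (Nat.le_mul_of_pos_left _ hM0).trans hn'
    refine ⟨n, by omega, ?_⟩
    rw [EReal.coe_le_coe_iff, negDigitMean_eq_two_add (by omega),
      backwardSum_digitSum_succ_sub_one hx]
    have hnpos : (0 : ℝ) < n := by
      have : 0 < n := by omega
      exact_mod_cast this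
    have : ((digitSum (2 * · + 1) i x : ℤ) : ℝ) / n ≤ z - 2 := by
      rw [div_le_iff₀ hnpos]
      rw [div_lt_iff₀ (by linarith)] at hM
      have c1 : (M : ℝ) * digitSum (2 * · + 1) i x ≤ n := by
        have : M * digitSum (2 * · + 1) i x ≤ n :=
          (Nat.mul_le_mul_left M (by omega)).trans hn'
        exact_mod_cast this
      push_cast
      have hE0 : (0 : ℝ) ≤ digitSum (2 * · + 1) i x := Nat.cast_nonneg _
      nlinarith
    linarith
  · refine le_liminf_of_le (by isBoundedDefault) ?_
    filter_upwards [eventually_ge_atTop 1] with n hn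
    exact EReal.coe_le_coe_iff.2 (two_le_negDigitMean hx hn)

/-- The time `n` is chosen to be at least the number of negative digits up to the end of the block
with the large last digit, yet much smaller than that digit. -/
lemma limsup_negDigitMean {x : ℝ} (hx : x ∈ irrUnit)
    (h : ∀ M r : ℕ, 1 ≤ M → 1 ≤ r →
      ∃ i, M * (r + digitSum id (2 * i + 1) x) ≤ digit (2 * i + 1) x) :
    limsup (fun n : ℕ => ((negDigitMean n x : ℝ) : EReal)) atTop = ⊤ := by
  refine EReal.eq_top_iff_forall_lt _ |>.2 fun z => ?_
  obtain ⟨M, hM⟩ := exists_nat_gt z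
  refine lt_of_lt_of_le (EReal.coe_lt_coe_iff.2 hM)
    (le_limsup_of_frequently_le' (frequently_atTop.2 fun n₀ => ?_))
  obtain ⟨i, hi⟩ := h (M + 1) (n₀ + 1) (by omega) (by omega)
  have hN : digitSum (2 * ·) (i + 1) x ≤ digitSum id (2 * i + 1) x := by
    have h1 : digitSum (2 * ·) (i + 1) x = digitSum (2 * ·) i x + digit (2 * i) x :=
      digitSum_succ _ _ _
    have h2 : digitSum id (2 * i + 1) x = digitSum id (2 * i) x + digit (2 * i) x :=
      digitSum_succ _ _ _
    have := digitSum_even_add_odd i x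
    omega
  have hE : digit (2 * i + 1) x ≤ digitSum (2 * · + 1) (i + 1) x := by
    rw [digitSum_succ]; omega
  set n := n₀ + 1 + digitSum id (2 * i + 1) x with hn
  refine ⟨n, by omega, EReal.coe_le_coe_iff.2 ?_⟩
  have hnpos : (0 : ℝ) < n := by
    have : 0 < n := by omega
    exact_mod_cast this
  have h1 := le_negDigitMean hx (m := i + 1) (n := n) (by omega) (by omega)
  have h2 : (M : ℝ) ≤ (digitSum (2 * · + 1) (i + 1) x : ℝ) / n := by
    rw [le_div_iff₀ hnpos]
    have : M * n ≤ digitSum (2 * · + 1) (i + 1) x :=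
      (Nat.mul_le_mul_right n (by omega)).trans (hi.trans hE)
    exact_mod_cast this
  linarith

lemma restrict_Ico_eq_unif : volume.restrict (Ico (0 : ℝ) 1) = unif :=
  (Measure.restrict_congr_set Ioo_ae_eq_Ico).symm

end

theorem proposition2p1 :
    (∀ ε : ℝ, 0 < ε →
      Tendsto (fun n : ℕ => volume {x : ℝ | x ∈ Ico (0 : ℝ) 1 ∧ |negDigitMean n x - 3| > ε})
        atTop (𝓝 0)) ∧
    (¬ ∀ᵐ x ∂(volume.restrict (Ico (0 : ℝ) 1)),
      Tendsto (fun n : ℕ => negDigitMean n x) atTop (𝓝 3)) ∧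
    (∀ᵐ x ∂(volume.restrict (Ico (0 : ℝ) 1)),
      liminf (fun n : ℕ => ((negDigitMean n x : ℝ) : EReal)) atTop = 2 ∧
      limsup (fun n : ℕ => ((negDigitMean n x : ℝ) : EReal)) atTop = ⊤) := by
  have hosc : ∀ᵐ x ∂unif,
      liminf (fun n : ℕ => ((negDigitMean n x : ℝ) : EReal)) atTop = 2 ∧
      limsup (fun n : ℕ => ((negDigitMean n x : ℝ) : EReal)) atTop = ⊤ := by
    have hlarge : ∀ p : ℕ, ∀ᵐ x ∂unif, ∀ M r : ℕ, 1 ≤ M → 1 ≤ r →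
        ∃ i, M * (r + digitSum id (2 * i + p) x) ≤ digit (2 * i + p) x := fun p => by
      simp only [ae_all_iff]
      exact fun M r hM hr => ae_exists_large_digit hM hr
    filter_upwards [ae_mem_irrUnit, hlarge 0, hlarge 1] with x hx h0 h1
    exact ⟨liminf_negDigitMean hx h0, limsup_negDigitMean hx h1⟩
  rw [restrict_Ico_eq_unif]
  refine ⟨fun ε hε => ?_, fun hlim => ?_, hosc⟩
  · convert tendsto_measure_negDigitMean hε using 2 with n
    rw [← restrict_Ico_eq_unif, Measure.restrict_apply' measurableSet_Ico, inter_comm]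
    rfl
  · obtain ⟨x, hx, h, -⟩ := (hlim.and hosc).exists
    have h3 := ((continuous_coe_real_ereal.tendsto 3).comp hx).liminf_eq
    have : (3 : ℝ) = 2 := EReal.coe_injective (h3.symm.trans h)
    norm_num at this
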